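/- \textbf{Conventions.} A subsemigroup $T$ of a semigroup $S$ is a \emph{subgroup} of $S$ if it is a group under the multiplication of $S$ (its identity need not be an identity of $S$). An element of $S$ is \emph{regular} if it belongs to some subgroup of $S$; then $a^{-1}$ denotes its inverse in that subgroup, i.e. the unique $b\in S$ with $ab=ba$, $a^2b=a$, $b^2a=b$. A subset of $S$ (or $S$ itself) is regular if all its elements are. For a regular subset $U$ of a monoid whose elements lie in a commutative submonoid, put $U^{-1}=\{a^{-1}: a\in U\}$ and let $[U]=U\otimes\langle U^{-1}\otimes U\rangle$ be the coset generated by $U$, where $\otimes$ is the product of sets and $\langle\cdot\rangle$ the generated submonoid. Maps, products and inverses extend coordinatewise to tuples. For a monoid $M$ and $R\subseteq M^r$, $(M,R)$ is the relational structure with universe $M$ and the relations $\{e_M\}$ (unary), $\{(a,b,c): ab=c\}$ (ternary) and $R$ ($r$-ary). A homomorphism of relational structures is a map that sends each relation into the corresponding relation; $\mathbb A\to\mathbb B$ means that one exists. An $n$-ary polymorphism of $(\mathbb A,\mathbb B)$ is a homomorphism $\mathbb A^n\to\mathbb B$; it is \emph{$2$-block symmetric}, for $n=2i+1$, if it is invariant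 under all permutations of its arguments that preserve the blocks $\{1,\dots,i+1\}$ and $\{i+2,\dots,2i+1\}$. Let $\mathbb A$ be a finite structure and $\mathbb X$ a finite structure with the same signature. Consider the linear system with an unknown $\lambda_x(a)$ for each $x\in X$, $a\in A$, and an unknown $\mu_{R,\mathbf x}(\mathbf a)$ for each symbol $R$, each $\mathbf x\in R^{\mathbb X}$ and each $\mathbf a\in R^{\mathbb A}$, and with the equations $\sum_{a}\lambda_x(a)=1$, $\sum_{\mathbf a}\mu_{R,\mathbf x}(\mathbf a)=1$ and $\sum_{\mathbf a:\,a_k=a}\mu_{R,\mathbf x}(\mathbf a)=\lambda_{x_k}(a)$. The algorithm BLP+AIP finds a point in the relative interior of the polytope of non-negative rational solutions and rejects if there is none; it then sets to $0$ all unknowns that are $0$ at that point, and accepts if and only if the system has an integer solution subject to this. \emph{$\mathrm{CSP}(\mathbb A)$ is solved by BLP+AIP} if for every finite $\mathbb X$ the algorithm accepts $\mathbb X$ if and only if $\mathbb X\to\mathbb A$. The \emph{commutative regularization} of a monoid $M$ is the regular commutative monoid $M^{\text{ab-reg}}$ with a homomorphism $\pi\colon M\to M^{\text{ab-reg}}$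 such that every homomorphism from $M$ to a regular commutative monoid factors uniquely through $\pi$. Explicitly, it is the commutative monoid presented by generators $\hat a,\check a,1_a$ ($a\in M$) and the relations $\prod_i\hat a_i=\prod_j\hat b_j$ whenever $\prod_i a_i=\prod_j b_j$ in $M$, $\hat a 1_a=\hat a$, $\check a 1_a=\check a$, $\hat a\check a=1_a$, $\hat e_M=e$, with $\pi(a)=\hat a$. \textbf{Proposition.} Let $M$ be a finitely generated monoid and $N$ a finite monoid, let $R^M\subseteq M^r$ and $R^N\subseteq N^r$, and put $\mathbb M=(M,R^M)$, $\mathbb N=(N,R^N)$. Assume that $\mathbb M\to\mathbb N$. The following are equivalent. \begin{enumerate} \item There is a homomorphism $h\colon\mathbb M\to\mathbb N$ with regular commutative image such that $[h(R^M)]\subseteq R^N$. \item For every $i\ge 0$ there is a $2$-block symmetric polymorphism of $(\mathbb M,\mathbb N)$ of arity $2i+1$. \item There is a finite structure $\mathbb A$ with $\mathbb M\to\mathbb A\to\mathbb N$ such that $\mathrm{CSP}(\mathbb A)$ is solved by BLP+AIP. \item There is a homomorphism from $(M^{\text{ab-reg}},[\pi(R^M)])$ to $\mathbb N$. \end{enumerate}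 -/

import Mathlib

open scoped Pointwise

universe u v

/-! ### Regular elements, inverses and cosets in monoids -/

/-- A subsemigroup `T` of `S` is a subgroup of `S` if it is a group under the multiplication of `S`.
Its identity need not be an identity of `S`. -/
def IsSubgroupOf {S : Type u} [Semigroup S] (T : Subsemigroup S) : Prop :=
  ∃ e ∈ T, (∀ s ∈ T, e * s = s ∧ s * e = s) ∧ ∀ s ∈ T, ∃ t ∈ T, s * t = e ∧ t * s = e

/-- An element is (completely) regular if it belongs to some subgroup. -/
def IsRegularElt {S : Type u} [Semigroup S] (a : S) : Prop :=
  ∃ T : Subsemigroup S, IsSubgroupOf T ∧ a ∈ T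

/-- A set is (completely) regular if all its elements are. -/
def IsRegularSet {S : Type u} [Semigroup S] (U : Set S) : Prop :=
  ∀ a ∈ U, IsRegularElt a

/-- A set is commutative if its elements commute with each other. -/
def IsCommutativeSet {S : Type u} [Semigroup S] (U : Set S) : Prop :=
  ∀ a ∈ U, ∀ b ∈ U, a * b = b * a

/-- `b` is the inverse of `a` in a subgroup that contains `a`. -/
def IsInverseOf {S : Type u} [Semigroup S] (a b : S) : Prop :=
  a * b = b * a ∧ a * a * b = a ∧ b * b * a = b

/-- Inverses are unique, and they exist exactly for the regular elements. -/
theorem IsInverseOf.unique {S : Type u} [Semigroup S] {a b c : S}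
    (hb : IsInverseOf a b) (hc : IsInverseOf a c) : b = c := by
  obtain ⟨b1, b2, b3⟩ := hb
  obtain ⟨c1, c2, c3⟩ := hc
  have key : a * b = a * c := by
    calc a * b = a * a * c * b := by rw [c2]
      _ = c * (a * a * b) := by rw [mul_assoc a a c, c1, ← mul_assoc, c1]; simp only [mul_assoc]
      _ = a * c := by rw [b2, c1]
  calc b = b * (a * b) := by rw [b1, ← mul_assoc, b3]
    _ = b * a * c := by rw [key, mul_assoc]
    _ = a * c * c := by rw [← b1, key]
    _ = c * c * a := by rw [mul_assoc c c a, ← c1, ← mul_assoc, ← c1]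
    _ = c := c3

theorem isRegularElt_iff_exists_isInverseOf {S : Type u} [Semigroup S] (a : S) :
    IsRegularElt a ↔ ∃ b, IsInverseOf a b := by
  constructor
  · rintro ⟨T, ⟨e, -, h1, h2⟩, ha⟩
    obtain ⟨t, ht, hat, hta⟩ := h2 a ha
    refine ⟨t, by rw [hat, hta], ?_, ?_⟩
    · rw [mul_assoc, hat, (h1 a ha).2]
    · rw [mul_assoc, hta, (h1 t ht).2]
  · rintro ⟨b, h1, h2, h3⟩
    have ee : a * b * (a * b) = a * b := by
      rw [mul_assoc, h1, ← mul_assoc b b a, h3, h1]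
    have ea : a * b * a = a := by rw [mul_assoc, ← h1, ← mul_assoc, h2]
    have ae : a * (a * b) = a := by rw [← mul_assoc, h2]
    have eb : a * b * b = b := by rw [h1, mul_assoc, h1, ← mul_assoc, h3]
    have be : b * (a * b) = b := by rw [h1, ← mul_assoc, h3]
    let T : Subsemigroup S :=
      { carrier := {x | a * b * x = x ∧ x * (a * b) = x ∧
          ∃ y, a * b * y = y ∧ y * (a * b) = y ∧ x * y = a * b ∧ y * x = a * b}
        mul_mem' := by
          rintro x x' ⟨p1, p2, y, y1, y2, y3, y4⟩ ⟨q1, q2, z, z1, z2, z3, z4⟩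
          refine ⟨by rw [← mul_assoc, p1], by rw [mul_assoc, q2], z * y,
            by rw [← mul_assoc, z1], by rw [mul_assoc, y2], ?_, ?_⟩
          · rw [mul_assoc, ← mul_assoc x', z3, y1, y3]
          · rw [mul_assoc, ← mul_assoc y, y4, q1, z4] }
    refine ⟨T, ⟨a * b, ⟨ee, ee, a * b, ee, ee, ee, ee⟩, fun s hs => ⟨hs.1, hs.2.1⟩, ?_⟩,
      ea, ae, b, eb, be, rfl, h1.symm⟩
    rintro s ⟨s1, s2, y, y1, y2, y3, y4⟩
    exact ⟨y, ⟨y1, y2, s, s1, s2, y4, y3⟩, y3, y4⟩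

/-- The set of inverses of the elements of `U`. -/
def inverseSet {S : Type u} [Semigroup S] (U : Set S) : Set S :=
  {b | ∃ a ∈ U, IsInverseOf a b}

/-- The coset `[U] = U ⊗ ⟨U⁻¹ ⊗ U⟩` generated by `U`, where `⊗` is the product of sets and
`⟨ ⟩` is the generated submonoid. -/
def cosetGen {M : Type u} [Monoid M] (U : Set M) : Set M :=
  U * (Submonoid.closure (inverseSet U * U) : Set M)

/-! ### Relational structures, homomorphisms, polymorphisms -/

/-- A finite relational signature. -/
structure RelSignature where
  Symb : Type
  finite_symb : Finite Symb
  arity : Symb → ℕ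

/-- A relational structure with universe `A`. -/
structure RelStructure (Sg : RelSignature) (A : Type u) where
  rel : (s : Sg.Symb) → Set (Fin (Sg.arity s) → A)

namespace RelStructure

variable {Sg : RelSignature} {A : Type u} {B : Type v}

/-- `f` is a homomorphism of relational structures. -/
def IsHom (SA : RelStructure Sg A) (SB : RelStructure Sg B) (f : A → B) : Prop :=
  ∀ s, ∀ t ∈ SA.rel s, f ∘ t ∈ SB.rel s

/-- There is a homomorphism. -/
def MapsTo (SA : RelStructure Sg A) (SB : RelStructure Sg B) : Prop :=
  ∃ f : A → B, SA.IsHom SB f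

/-- The `n`-th Cartesian power. -/
def pow (SA : RelStructure Sg A) (n : ℕ) : RelStructure Sg (Fin n → A) where
  rel s := {t | ∀ j : Fin n, (fun k => t k j) ∈ SA.rel s}

/-- `f` is an `n`-ary polymorphism of the pair `(SA, SB)`. -/
def IsPolymorphism (SA : RelStructure Sg A) (SB : RelStructure Sg B) {n : ℕ}
    (f : (Fin n → A) → B) : Prop :=
  (SA.pow n).IsHom SB f

end RelStructure

/-- `f`, of arity `2 * i + 1`, is invariant under all permutations of its arguments that preserve
the block of the first `i + 1` coordinates (and hence the block of the last `i`). -/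
def IsTwoBlockSymmetric {A : Type u} {B : Type v} (i : ℕ)
    (f : (Fin (2 * i + 1) → A) → B) : Prop :=
  ∀ p : Equiv.Perm (Fin (2 * i + 1)),
    (∀ j, (p j : ℕ) < i + 1 ↔ (j : ℕ) < i + 1) → ∀ a, f (a ∘ p) = f a

/-! ### Expansions of monoids by one relation -/

/-- The symbols: unary for the identity, ternary for the product, and one further symbol. -/
inductive ExpSymb
  | one
  | mul
  | extra

theorem ExpSymb.finite : Finite ExpSymb :=
  Finite.of_injective
    (fun s => match s with
      | .one => (0 : Fin 3)
      | .mul => 1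
      | .extra => 2)
    (by intro a b h; cases a <;> cases b <;> simp_all)

/-- The signature of expansions of monoids by a relation of arity `r`. -/
def expSignature (r : ℕ) : RelSignature where
  Symb := ExpSymb
  finite_symb := ExpSymb.finite
  arity s := match s with
    | .one => 1
    | .mul => 3
    | .extra => r

/-- The relational structure `(M, R)`. -/
def expansion (M : Type u) [Monoid M] {r : ℕ} (R : Set (Fin r → M)) :
    RelStructure (expSignature r) M where
  rel s := match s with
    | .one => {t : Fin 1 → M | t 0 = 1}
    | .mul => {t : Fin 3 → M | t 0 * t 1 = t 2}
    | .extra => R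

/-! ### The BLP + AIP algorithm -/

section BLPAIP

variable {Sg : RelSignature}

namespace RelStructure

/-- The constraints of an instance: a symbol together with a tuple in its relation. -/
def Constraint {X : Type} (SX : RelStructure Sg X) : Type :=
  Σ s : Sg.Symb, {t : Fin (Sg.arity s) → X // t ∈ SX.rel s}

/-- The variables of the relaxations: one for each pair of a vertex of the instance and a value, and
one for each pair of a constraint of the instance and a tuple of the template's relation. -/
def RelaxVar {X A : Type} (SX : RelStructure Sg X) (SA : RelStructure Sg A) : Type :=
  (X × A) ⊕ (Σ c : SX.Constraint, {w : Fin (Sg.arity c.1) → A // w ∈ SA.rel c.1})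

open Classical in
/-- The linear system shared by both relaxations, over a ring `K`. Weights of the values at each
vertex sum to one, so do the weights of the tuples at each constraint, and the marginals of the
latter are the former. -/
def IsRelaxSolution (K : Type) [CommRing K] {X A : Type} [Fintype A]
    (SX : RelStructure Sg X) (SA : RelStructure Sg A) (p : SX.RelaxVar SA → K) : Prop :=
  (∀ x : X, ∑ a : A, p (Sum.inl (x, a)) = 1) ∧
  (∀ c : SX.Constraint, ∑ w, p (Sum.inr ⟨c, w⟩) = 1) ∧
  (∀ (c : SX.Constraint) (k : Fin (Sg.arity c.1)) (a : A),
    ∑ w, (if w.1 k = a then p (Sum.inr ⟨c, w⟩) else 0) = p (Sum.inl (c.2.1 k, a)))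

/-- The polytope of the basic linear programming relaxation. -/
def blpPolytope {X A : Type} [Fintype A] (SX : RelStructure Sg X) (SA : RelStructure Sg A) :
    Set (SX.RelaxVar SA → ℚ) :=
  {p | IsRelaxSolution ℚ SX SA p ∧ ∀ v, 0 ≤ p v}

/-- BLP + AIP accepts the instance `SX` of the template `SA`: the basic linear program has a point
`p` in its relative interior, and the affine integer relaxation, in which each variable that `p`
sets to zero is set to zero, has a solution. (The zero set of `p` does not depend on the choice of
the relative interior point.) -/
def BLPAIPAccepts {X A : Type} [Fintype A] (SX : RelStructure Sg X) (SA : RelStructure Sg A) :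
    Prop :=
  ∃ p ∈ intrinsicInterior ℚ (SX.blpPolytope SA),
    ∃ q : SX.RelaxVar SA → ℤ, IsRelaxSolution ℤ SX SA q ∧ ∀ v, p v = 0 → q v = 0

/-- `CSP(SA)` is solved by BLP + AIP: on each finite instance the algorithm accepts if and only if
the instance maps homomorphically to the template. -/
def SolvedByBLPAIP {A : Type} [Fintype A] (SA : RelStructure Sg A) : Prop :=
  ∀ (X : Type) [Finite X] (SX : RelStructure Sg X), SX.BLPAIPAccepts SA ↔ SX.MapsTo SA

end RelStructure

end BLPAIP

/-! ### The commutative regularization of a monoid -/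

/-- The generators: a copy of each element `a`, a formal inverse and a formal idempotent of it. -/
inductive AbRegGen (M : Type u)
  | hat (a : M)
  | check (a : M)
  | idem (a : M)

/-- The defining relations. -/
inductive AbRegRel (M : Type u) [Monoid M] :
    FreeMonoid (AbRegGen M) → FreeMonoid (AbRegGen M) → Prop
  | word (l₁ l₂ : List M) (h : l₁.prod = l₂.prod) :
      AbRegRel M (l₁.map fun a => FreeMonoid.of (.hat a)).prod
        (l₂.map fun a => FreeMonoid.of (.hat a)).prod
  | hat_idem (a : M) :
      AbRegRel M (FreeMonoid.of (.hat a) * FreeMonoid.of (.idem a)) (FreeMonoid.of (.hat a))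
  | check_idem (a : M) :
      AbRegRel M (FreeMonoid.of (.check a) * FreeMonoid.of (.idem a)) (FreeMonoid.of (.check a))
  | hat_check (a : M) :
      AbRegRel M (FreeMonoid.of (.hat a) * FreeMonoid.of (.check a)) (FreeMonoid.of (.idem a))
  | hat_one : AbRegRel M (FreeMonoid.of (.hat 1)) 1
  | comm (x y : AbRegGen M) :
      AbRegRel M (FreeMonoid.of x * FreeMonoid.of y) (FreeMonoid.of y * FreeMonoid.of x)

/-- The commutative regularization of a monoid. -/
abbrev AbReg (M : Type u) [Monoid M] : Type u := PresentedMonoid (AbRegRel M)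

namespace AbReg

variable (M : Type u) [Monoid M]

/-- The canonical homomorphism from a monoid to its commutative regularization. -/
def proj : M →* AbReg M where
  toFun a := PresentedMonoid.of (AbRegRel M) (.hat a)
  map_one' := PresentedMonoid.mk_eq_mk_of_rel AbRegRel.hat_one
  map_mul' a b := by
    have h := PresentedMonoid.mk_eq_mk_of_rel (AbRegRel.word [a * b] [a, b] (by simp))
    simpa [PresentedMonoid.of] using h

/-! The regularization is commutative and regular, and has the expected universal property. -/

theorem mul_comm' (x y : AbReg M) : x * y = y * x := by
  have hx : x ∈ Submonoid.closure (Set.range (PresentedMonoid.of (AbRegRel M))) := by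
    rw [PresentedMonoid.closure_range_of]; trivial
  have hy : y ∈ Submonoid.closure (Set.range (PresentedMonoid.of (AbRegRel M))) := by
    rw [PresentedMonoid.closure_range_of]; trivial
  have gen : ∀ s t, PresentedMonoid.of (AbRegRel M) s * PresentedMonoid.of (AbRegRel M) t =
      PresentedMonoid.of (AbRegRel M) t * PresentedMonoid.of (AbRegRel M) s := fun s t =>
    PresentedMonoid.mk_eq_mk_of_rel (AbRegRel.comm s t)
  induction hx using Submonoid.closure_induction with
  | one => simp
  | mul a b _ _ ha hb => rw [mul_assoc, hb, ← mul_assoc, ha, mul_assoc]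
  | mem a ha =>
    obtain ⟨s, rfl⟩ := ha
    induction hy using Submonoid.closure_induction with
    | one => simp
    | mul a b _ _ ha hb => rw [← mul_assoc, ha, mul_assoc, hb, ← mul_assoc]
    | mem b hb =>
      obtain ⟨t, rfl⟩ := hb
      exact gen s t

instance : CommMonoid (AbReg M) where
  mul_comm := mul_comm' M

theorem isRegularElt (x : AbReg M) : IsRegularElt x := by
  rw [isRegularElt_iff_exists_isInverseOf]
  have hx : x ∈ Submonoid.closure (Set.range (PresentedMonoid.of (AbRegRel M))) := by
    rw [PresentedMonoid.closure_range_of]; trivial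
  have e1 : ∀ a : M, PresentedMonoid.of (AbRegRel M) (.hat a) *
      PresentedMonoid.of (AbRegRel M) (.idem a) = PresentedMonoid.of (AbRegRel M) (.hat a) :=
    fun a => PresentedMonoid.mk_eq_mk_of_rel (AbRegRel.hat_idem a)
  have e2 : ∀ a : M, PresentedMonoid.of (AbRegRel M) (.check a) *
      PresentedMonoid.of (AbRegRel M) (.idem a) = PresentedMonoid.of (AbRegRel M) (.check a) :=
    fun a => PresentedMonoid.mk_eq_mk_of_rel (AbRegRel.check_idem a)
  have e3 : ∀ a : M, PresentedMonoid.of (AbRegRel M) (.hat a) *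
      PresentedMonoid.of (AbRegRel M) (.check a) = PresentedMonoid.of (AbRegRel M) (.idem a) :=
    fun a => PresentedMonoid.mk_eq_mk_of_rel (AbRegRel.hat_check a)
  induction hx using Submonoid.closure_induction with
  | one => exact ⟨1, by simp [IsInverseOf]⟩
  | mul a b _ _ ha hb =>
    obtain ⟨a', -, a2, a3⟩ := ha
    obtain ⟨b', -, b2, b3⟩ := hb
    refine ⟨a' * b', mul_comm _ _, ?_, ?_⟩
    · calc a * b * (a * b) * (a' * b') = (a * a * a') * (b * b * b') := by
            simp only [mul_assoc, mul_left_comm]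
        _ = a * b := by rw [a2, b2]
    · calc a' * b' * (a' * b') * (a * b) = (a' * a' * a) * (b' * b' * b) := by
            simp only [mul_assoc, mul_left_comm]
        _ = a' * b' := by rw [a3, b3]
  | mem a ha =>
    obtain ⟨s, rfl⟩ := ha
    cases s with
    | hat a =>
      refine ⟨PresentedMonoid.of (AbRegRel M) (.check a), mul_comm _ _, ?_, ?_⟩
      · rw [mul_assoc, e3, e1]
      · rw [mul_assoc, mul_comm (PresentedMonoid.of (AbRegRel M) (.check a))
          (PresentedMonoid.of (AbRegRel M) (.hat a)), e3, e2]
    | check a =>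
      refine ⟨PresentedMonoid.of (AbRegRel M) (.hat a), mul_comm _ _, ?_, ?_⟩
      · rw [mul_assoc, mul_comm (PresentedMonoid.of (AbRegRel M) (.check a))
          (PresentedMonoid.of (AbRegRel M) (.hat a)), e3, e2]
      · rw [mul_assoc, e3, e1]
    | idem a =>
      have e4 : PresentedMonoid.of (AbRegRel M) (.idem a) *
          PresentedMonoid.of (AbRegRel M) (.idem a) =
          PresentedMonoid.of (AbRegRel M) (.idem a) := by
        conv_lhs => rw [← e3 a, mul_assoc, e3 a, e2 a, e3 a]
      refine ⟨PresentedMonoid.of (AbRegRel M) (.idem a), mul_comm _ _, ?_, ?_⟩ <;>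
        rw [e4, e4]

theorem existsUnique_lift {K : Type v} [CommMonoid K] (hK : ∀ x : K, IsRegularElt x)
    (f : M →* K) : ∃! g : AbReg M →* K, g.comp (proj M) = f := by
  have hinv : ∀ a : M, ∃ b, IsInverseOf (f a) b := fun a =>
    (isRegularElt_iff_exists_isInverseOf _).1 (hK (f a))
  choose inv h1 h2 h3 using hinv
  let F : AbRegGen M → K := fun s => match s with
    | .hat a => f a
    | .check a => inv a
    | .idem a => f a * inv a
  have hF : ∀ x y, AbRegRel M x y → FreeMonoid.lift F x = FreeMonoid.lift F y := by
    intro x y h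
    cases h with
    | word l₁ l₂ h =>
      have key : ∀ l : List M,
          FreeMonoid.lift F (l.map fun a => FreeMonoid.of (.hat a)).prod = f l.prod := by
        intro l
        induction l with
        | nil => simp
        | cons a l ih => rw [List.map_cons, List.prod_cons, map_mul, ih]; simp [F]
      rw [key, key, h]
    | hat_idem a => simp [F, ← mul_assoc, h2]
    | check_idem a => simp only [map_mul, FreeMonoid.lift_eval_of, F]; rw [h1, ← mul_assoc, h3]
    | hat_check a => simp [F]
    | hat_one => simp [F]
    | comm x y => simp [mul_comm]
  refine ⟨PresentedMonoid.lift F hF, by ext a; rfl, ?_⟩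
  rintro g rfl
  refine PresentedMonoid.ext (AbRegRel M) (fun s => ?_)
  have e1 : ∀ a : M, PresentedMonoid.of (AbRegRel M) (.hat a) *
      PresentedMonoid.of (AbRegRel M) (.idem a) = PresentedMonoid.of (AbRegRel M) (.hat a) :=
    fun a => PresentedMonoid.mk_eq_mk_of_rel (AbRegRel.hat_idem a)
  have e2 : ∀ a : M, PresentedMonoid.of (AbRegRel M) (.check a) *
      PresentedMonoid.of (AbRegRel M) (.idem a) = PresentedMonoid.of (AbRegRel M) (.check a) :=
    fun a => PresentedMonoid.mk_eq_mk_of_rel (AbRegRel.check_idem a)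
  have e3 : ∀ a : M, PresentedMonoid.of (AbRegRel M) (.hat a) *
      PresentedMonoid.of (AbRegRel M) (.check a) = PresentedMonoid.of (AbRegRel M) (.idem a) :=
    fun a => PresentedMonoid.mk_eq_mk_of_rel (AbRegRel.hat_check a)
  have hc : ∀ a, g (PresentedMonoid.of (AbRegRel M) (.check a)) = inv a := by
    intro a
    refine IsInverseOf.unique (a := g (proj M a)) ?_ ⟨h1 a, h2 a, h3 a⟩
    change IsInverseOf (g (PresentedMonoid.of (AbRegRel M) (.hat a))) _
    refine ⟨mul_comm _ _, ?_, ?_⟩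
    · rw [mul_assoc, ← map_mul, e3, ← map_mul, e1]
    · rw [mul_assoc, mul_comm (g (PresentedMonoid.of (AbRegRel M) (.check a)))
        (g (PresentedMonoid.of (AbRegRel M) (.hat a))), ← map_mul, e3, ← map_mul, e2]
  cases s with
  | hat a => rfl
  | check a => rw [hc]; rfl
  | idem a => rw [← e3, map_mul, hc]; rfl

end AbReg

/-! Fix `ω > 1` such that all `ω`-th powers in the finite monoid at hand are idempotent. A regular
`x` then satisfies `x ^ (ω + 1) = x` and its inverse is a power of `x`. Hence the coset generated by
a commuting regular set consists of the products of its elements whose number of factors is 1 modulo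
`ω` (`mem_gradedClosure_of_mem_cosetGen`, `mem_cosetGen_of_mem_gradedClosure`). Most of the proof
works with this description.

(1) ⇔ (4) is the universal property of the regularization, applied to the image of `h`, together
with the compatibility of cosets with homomorphisms.

(1) ⇒ (3): the template is the image of `h`, expanded by a coset. A point of the BLP polytope and an
AIP solution supported inside its support combine to a solution in natural numbers with sums 1
modulo `ω`. Used as exponents, these numbers turn the values at each vertex into one value, and the
marginal equations together with the closure of cosets make this a homomorphism
(`solvedByBLPAIP_of_closed`).

(3) ⇒ (2): a block symmetric polymorphism is a homomorphism from the quotient of a power by block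
permutations. Each finite substructure of the quotient is accepted, with weight 1 on the coordinates
of the first block and -1 on those of the second; compactness does the rest.

(2) ⇒ (1): a block symmetric homomorphism on a power is given by two homomorphisms `γ`, `γ'` with
commuting values. By finite generation some pair serves infinitely many arities, and `γ ^ (ω + 1) *
γ' ^ ω` is the required map: long polymorphisms of that pair produce every element of the coset
(`components_mem_of_lists`). -/

/-! ### Exponents, inverses and cosets -/

/-- A finite monoid has a positive exponent that makes all its elements idempotent. -/
theorem exists_idempotent_exponent (N : Type*) [Monoid N] [Finite N] :
    ∃ ω : ℕ, 1 < ω ∧ ∀ x : N, x ^ ω * x ^ ω = x ^ ω := by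
  have h : ∀ x : N, ∃ k : ℕ, 0 < k ∧ x ^ k * x ^ k = x ^ k := by
    intro x
    obtain ⟨m, n, hmn, hx⟩ := Finite.exists_ne_map_eq_of_infinite (fun n : ℕ => x ^ n)
    wlog hlt : m < n generalizing m n
    · exact this n m hmn.symm hx.symm (by omega)
    have step : ∀ j a, x ^ (m + a + j * (n - m)) = x ^ (m + a) := by
      intro j
      induction j with
      | zero => simp
      | succ j ih =>
        intro a
        have : m + a + (j + 1) * (n - m) = n + (a + j * (n - m)) := by
          rw [add_mul]; omega
        rw [this, pow_add, show x ^ n = x ^ m from hx.symm, ← pow_add, ← add_assoc, ih]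
    -- The exponent must be a multiple of the period `n - m` and no smaller than the preperiod `m`.
    refine ⟨(m + 1) * (n - m), by have := Nat.sub_pos_of_lt hlt; positivity, ?_⟩
    have hle : m ≤ (m + 1) * (n - m) := by nlinarith [Nat.sub_pos_of_lt hlt]
    obtain ⟨a, ha⟩ := Nat.exists_eq_add_of_le hle
    rw [← pow_add]
    conv_lhs => rw [show (m + 1) * (n - m) + (m + 1) * (n - m) = m + a + (m + 1) * (n - m) by omega]
    rw [step, ← ha]
  choose k hk hx using h
  have := Fintype.ofFinite N
  have hpos : 0 < ∏ x, k x := Finset.prod_pos fun x _ => hk x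
  -- The factor 2 serves only to make the exponent exceed 1.
  refine ⟨(∏ x, k x) * 2, by omega, fun x => ?_⟩
  obtain ⟨c, hc⟩ := (Finset.dvd_prod_of_mem k (Finset.mem_univ x)).mul_right 2
  rw [hc, pow_mul, ← (Commute.refl _).mul_pow, hx]

theorem pow_add_idempotent {N : Type*} [Monoid N] {ω : ℕ} {x : N}
    (hx : x ^ ω * x ^ ω = x ^ ω) (a k : ℕ) (ha : ω ≤ a) : x ^ (a + k * ω) = x ^ a := by
  obtain ⟨b, rfl⟩ := Nat.exists_eq_add_of_le ha
  induction k with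
  | zero => simp
  | succ k ih =>
    rw [← ih, show ω + b + (k + 1) * ω = ω + ω + (b + k * ω) by ring, pow_add, pow_add x ω ω, hx,
      ← pow_add, add_assoc]

theorem IsRegularElt.pow_succ_eq {N : Type*} [Monoid N] {ω : ℕ} {x : N} (h : IsRegularElt x)
    (hx : x ^ ω * x ^ ω = x ^ ω) : x ^ (ω + 1) = x := by
  obtain ⟨b, h1, h2, -⟩ := (isRegularElt_iff_exists_isInverseOf x).1 h
  have key : ∀ n, x ^ (n + 1) * b ^ n = x := by
    intro n
    induction n with
    | zero => simp
    | succ n ih =>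
      rw [pow_succ x (n + 1), pow_succ' b n, mul_assoc, ← mul_assoc x b, ← mul_assoc, pow_succ x n,
        mul_assoc (x ^ n), ← mul_assoc x x b, h2, ← pow_succ, ih]
  rw [pow_succ']
  nth_rewrite 1 [← key ω]
  have hc : Commute x b := h1
  rw [mul_assoc, (hc.symm.pow_pow ω ω).eq, ← mul_assoc, pow_succ', mul_assoc x, hx, ← pow_succ',
    key]

/-- Powers of `x` form a cycle of length dividing `ω`, so the inverse has exponent -1 modulo `ω`.
The representative `2 * ω - 1`, unlike `ω - 1`, is positive even when `ω = 1`. -/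
theorem isInverseOf_pow {N : Type*} [Monoid N] {ω : ℕ} (hω : 0 < ω) {x : N}
    (hx : x ^ (ω + 1) = x) : IsInverseOf x (x ^ (2 * ω - 1)) := by
  have e : x * x ^ (2 * ω - 1) = x ^ ω * x ^ ω := by
    rw [← pow_succ', ← pow_add]; congr 1; omega
  have e' : x ^ (2 * ω - 1) * x = x ^ ω * x ^ ω := by
    rw [← pow_succ, ← pow_add]; congr 1; omega
  refine ⟨by rw [e, e'], ?_, ?_⟩
  · rw [mul_assoc, e, ← mul_assoc, ← pow_succ', hx, ← pow_succ', hx]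
  · rw [mul_assoc, e', ← pow_add, ← pow_add]
    have : ∀ n, x ^ (n + 1 + ω) = x ^ (n + 1) := fun n => by
      rw [add_assoc, add_comm 1 ω, pow_add, hx, pow_succ]
    obtain ⟨c, hc⟩ : ∃ c, 2 * ω - 1 = c + 1 := ⟨2 * ω - 2, by omega⟩
    rw [hc, ← add_assoc, show c + 1 + ω + ω = c + ω + 1 + ω by omega, this, add_right_comm, this]

/-! ### Inverses and cosets under homomorphisms and in powers. -/

theorem IsInverseOf.map {S T : Type*} [Monoid S] [Monoid T] (f : S →* T) {a b : S}
    (h : IsInverseOf a b) : IsInverseOf (f a) (f b) := by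
  obtain ⟨h1, h2, h3⟩ := h
  exact ⟨by rw [← map_mul, h1, map_mul], by rw [← map_mul, ← map_mul, h2],
    by rw [← map_mul, ← map_mul, h3]⟩

theorem isInverseOf_pi {ι S : Type*} [Monoid S] {a b : ι → S} :
    IsInverseOf a b ↔ ∀ i, IsInverseOf (a i) (b i) := by
  simp only [IsInverseOf, funext_iff, Pi.mul_apply, forall_and]

theorem isRegularElt_pi {ι S : Type*} [Monoid S] (hS : ∀ x : S, IsRegularElt x) (t : ι → S) :
    IsRegularElt t := by
  have h := fun i => (isRegularElt_iff_exists_isInverseOf _).1 (hS (t i))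
  choose b hb using h
  exact (isRegularElt_iff_exists_isInverseOf _).2 ⟨b, isInverseOf_pi.2 hb⟩

theorem subset_cosetGen {P : Type*} [Monoid P] (U : Set P) : U ⊆ cosetGen U := fun u hu =>
  ⟨u, hu, 1, one_mem _, mul_one u⟩

theorem image_inverseSet_subset {P Q : Type*} [Monoid P] [Monoid Q] (f : P →* Q) (U : Set P) :
    f '' inverseSet U ⊆ inverseSet (f '' U) := by
  rintro _ ⟨b, ⟨a, ha, hab⟩, rfl⟩
  exact ⟨f a, ⟨a, ha, rfl⟩, hab.map f⟩

theorem image_cosetGen {P Q : Type*} [Monoid P] [Monoid Q] (f : P →* Q) (U : Set P) :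
    f '' cosetGen U = f '' U * (Submonoid.closure (f '' inverseSet U * f '' U) : Set Q) := by
  have : Submonoid.closure (f '' inverseSet U * f '' U) =
      (Submonoid.closure (inverseSet U * U)).map f := by
    rw [← Set.image_mul f, MonoidHom.map_mclosure]
  rw [cosetGen, Set.image_mul f, this, Submonoid.coe_map]

theorem image_cosetGen_subset {P Q : Type*} [Monoid P] [Monoid Q] (f : P →* Q) (U : Set P) :
    f '' cosetGen U ⊆ cosetGen (f '' U) := by
  rw [image_cosetGen, cosetGen]
  exact Set.mul_subset_mul_left
    (Submonoid.closure_mono (Set.mul_subset_mul_right (image_inverseSet_subset f U)))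

/-- Regularity of `U` is what gives equality: otherwise `f a` could have an inverse although `a` has
none. -/
theorem cosetGen_image {P Q : Type*} [Monoid P] [Monoid Q] (f : P →* Q) {U : Set P}
    (hU : IsRegularSet U) : cosetGen (f '' U) = f '' cosetGen U := by
  have : inverseSet (f '' U) = f '' inverseSet U := by
    refine Set.Subset.antisymm ?_ (image_inverseSet_subset f U)
    rintro c ⟨_, ⟨a, ha, rfl⟩, hc⟩
    obtain ⟨b, hb⟩ := (isRegularElt_iff_exists_isInverseOf a).1 (hU a ha)
    exact ⟨b, ⟨a, ha, hb⟩, (hb.map f).unique hc⟩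
  rw [image_cosetGen, cosetGen, this]

/-! ### Cosets as products whose number of factors is 1 modulo `ω`. -/

/-- The submonoid of the pairs of a product of elements of `U` and the number of its factors,
modulo `ω`. -/
def gradedClosure {P : Type*} [Monoid P] (ω : ℕ) (U : Set P) :
    Submonoid (P × Multiplicative (ZMod ω)) :=
  Submonoid.closure ((fun u => (u, Multiplicative.ofAdd 1)) '' U)

theorem exists_list_of_mem_gradedClosure {P ι : Type*} [Monoid P] {ω : ℕ} (f : ι → P) {R : Set ι}
    {x : P × Multiplicative (ZMod ω)} (hx : x ∈ gradedClosure ω (f '' R)) :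
    ∃ l : List ι, (∀ t ∈ l, t ∈ R) ∧
      ((l.map f).prod, Multiplicative.ofAdd (l.length : ZMod ω)) = x := by
  induction hx using Submonoid.closure_induction with
  | mem x hx =>
    obtain ⟨_, ⟨t, ht, rfl⟩, rfl⟩ := hx
    exact ⟨[t], by simpa using ht, by simp⟩
  | one => exact ⟨[], by simp, by simp⟩
  | mul x y _ _ hx hy =>
    obtain ⟨l, hl, rfl⟩ := hx
    obtain ⟨m, hm, rfl⟩ := hy
    refine ⟨l ++ m, by simpa [or_imp, forall_and] using ⟨hl, hm⟩, by simp⟩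

theorem exists_cons_of_mem_gradedClosure {P ι : Type*} [Monoid P] {ω : ℕ} (hω : 1 < ω) (f : ι → P)
    {R : Set ι} {x : P} (hx : (x, Multiplicative.ofAdd 1) ∈ gradedClosure ω (f '' R)) :
    ∃ (s : ι) (l : List ι) (k : ℕ), s ∈ R ∧ (∀ t ∈ l, t ∈ R) ∧ l.length = k * ω ∧
      f s * (l.map f).prod = x := by
  obtain ⟨l, hl, hlx⟩ := exists_list_of_mem_gradedClosure f hx
  obtain ⟨rfl, e⟩ := Prod.mk.inj hlx
  replace e := Multiplicative.ofAdd.injective e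
  cases l with
  -- The empty product has degree 0, which differs from 1 because `ω > 1`.
  | nil =>
    have : Fact (1 < ω) := ⟨hω⟩
    simp at e
  | cons s l =>
    obtain ⟨k, hk⟩ := (ZMod.natCast_eq_zero_iff l.length ω).1 (by simpa using e)
    exact ⟨s, l, k, hl s (by simp), fun u hu => hl u (by simp [hu]), by rw [hk, mul_comm],
      by simp⟩

/-- An inverse is a power with exponent -1 modulo `ω`, so the generators `a⁻¹ * d` have degree 0.
Commutativity plays no role in this direction. -/
theorem mem_gradedClosure_of_mem_cosetGen {P : Type*} [Monoid P] {ω : ℕ} (hω : 0 < ω) {U : Set P}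
    (hU : ∀ u ∈ U, u ^ (ω + 1) = u) {x : P} (hx : x ∈ cosetGen U) :
    (x, Multiplicative.ofAdd 1) ∈ gradedClosure ω U := by
  have mem : ∀ u ∈ U, (u, Multiplicative.ofAdd (1 : ZMod ω)) ∈ gradedClosure ω U := fun u hu =>
    Submonoid.subset_closure ⟨u, hu, rfl⟩
  obtain ⟨u, hu, c, hc, rfl⟩ := hx
  have hc' : (c, (1 : Multiplicative (ZMod ω))) ∈ gradedClosure ω U := by
    induction hc using Submonoid.closure_induction with
    | mem c hc =>
      obtain ⟨b, ⟨a, ha, hab⟩, d, hd, rfl⟩ := hc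
      rw [hab.unique (isInverseOf_pow hω (hU a ha))]
      convert mul_mem (pow_mem (mem a ha) (2 * ω - 1)) (mem d hd) using 1
      rw [Prod.pow_mk, Prod.mk_mul_mk, ← ofAdd_nsmul, ← ofAdd_add, ← succ_nsmul,
        show 2 * ω - 1 + 1 = 2 * ω by omega]
      simp
    | one => exact one_mem _
    | mul x y _ _ hx hy => simpa using mul_mem hx hy
  simpa using mul_mem (mem u hu) hc'

/-- A product of degree 1 is `s` times a product of `k * ω` further factors. Since `s` absorbs
`ω`-th powers of its inverse, one copy of `s⁻¹` can be attached to each of these factors. -/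
theorem mem_cosetGen_of_mem_gradedClosure {P : Type*} [CommMonoid P] {ω : ℕ} (hω : 1 < ω)
    {U : Set P} (hU : ∀ u ∈ U, u ^ (ω + 1) = u) {x : P}
    (hx : (x, Multiplicative.ofAdd 1) ∈ gradedClosure ω U) : x ∈ cosetGen U := by
  rw [← Set.image_id U] at hx
  obtain ⟨s, l, k, hs, hl, hk, rfl⟩ := exists_cons_of_mem_gradedClosure hω id hx
  have inv := isInverseOf_pow (by omega) (hU s hs)
  have h1 : (s ^ (2 * ω - 1)) ^ l.length * l.prod ∈ Submonoid.closure (inverseSet U * U) := by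
    clear hk hx
    induction l with
    | nil => simp
    | cons a l ih =>
      rw [List.length_cons, List.prod_cons, pow_succ', mul_mul_mul_comm]
      exact mul_mem (Submonoid.subset_closure ⟨_, ⟨s, hs, inv⟩, a, hl a (by simp), rfl⟩)
        (ih fun u hu => hl u (by simp [hu]))
  refine ⟨s, hs, _, h1, ?_⟩
  have h2 : ∀ j, s * s ^ (j * ω) = s := by
    intro j
    induction j with
    | zero => simp
    | succ j ih => rw [add_mul, one_mul, pow_add, ← mul_assoc, ih, ← pow_succ', hU s hs]
  change s * ((s ^ (2 * ω - 1)) ^ l.length * l.prod) = _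
  rw [← mul_assoc, hk, ← pow_mul, show (2 * ω - 1) * (k * ω) = ((2 * ω - 1) * k) * ω by ring, h2,
    List.map_id, id]

/-! ### Expansions of monoids and their homomorphisms -/

theorem expansion_isHom_iff {M : Type u} {N : Type v} [Monoid M] [Monoid N] {r : ℕ}
    {RM : Set (Fin r → M)} {RN : Set (Fin r → N)} {f : M → N} :
    (expansion M RM).IsHom (expansion N RN) f ↔
      f 1 = 1 ∧ (∀ a b, f (a * b) = f a * f b) ∧ ∀ t ∈ RM, f ∘ t ∈ RN := by
  constructor
  · intro h
    exact ⟨h .one (fun _ => (1 : M)) rfl, fun a b => (h .mul ![a, b, a * b] rfl).symm,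
      fun t ht => h .extra t ht⟩
  · rintro ⟨h1, h2, h3⟩ s t ht
    cases s with
    | one => exact (congrArg f ht).trans h1
    | mul => exact (h2 _ _).symm.trans (congrArg f ht)
    | extra => exact h3 t ht

/-- A monoid homomorphism that respects the relation is a homomorphism of the expansions. -/
theorem MonoidHom.expansion_isHom {M : Type u} {N : Type v} [Monoid M] [Monoid N] {r : ℕ}
    {RM : Set (Fin r → M)} {RN : Set (Fin r → N)} (f : M →* N) (h : ∀ t ∈ RM, f ∘ t ∈ RN) :
    (expansion M RM).IsHom (expansion N RN) f :=
  expansion_isHom_iff.2 ⟨map_one f, map_mul f, h⟩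

theorem expansion_isPolymorphism {M : Type u} {N : Type v} [Monoid M] [Monoid N] {r n : ℕ}
    {RM : Set (Fin r → M)} {RN : Set (Fin r → N)} {f : (Fin n → M) → N}
    (h : (expansion M RM).IsPolymorphism (expansion N RN) f) :
    ∃ F : (Fin n → M) →* N, ⇑F = f ∧
      ∀ T : Fin n → Fin r → M, (∀ j, T j ∈ RM) → (fun k => F fun j => T j k) ∈ RN :=
  ⟨{ toFun := f
     map_one' := h .one (fun _ => (1 : Fin n → M)) fun _ => rfl
     map_mul' := fun a b => (h .mul ![a, b, a * b] fun _ => rfl).symm }, rfl,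
    fun T hT => h .extra (fun k j => T j k) hT⟩

/-- A homomorphism with regular commutative image factors through a finite regular commutative
monoid. -/
theorem exists_factorization {M : Type u} {N : Type v} [Monoid M] [Monoid N] [Finite N]
    (h : M →* N) (hreg : IsRegularSet (Set.range h)) (hcomm : IsCommutativeSet (Set.range h)) :
    ∃ (K : Type v) (_ : CommMonoid K) (_ : Finite K) (g : M →* K) (ι : K →* N),
      (∀ x : K, IsRegularElt x) ∧ ι.comp g = h := by
  obtain ⟨ω, hω, hid⟩ := exists_idempotent_exponent N
  let _ : CommMonoid (MonoidHom.mrange h) :=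
    { (inferInstance : Monoid (MonoidHom.mrange h)) with
      mul_comm := fun a b => Subtype.ext (hcomm a a.2 b b.2) }
  refine ⟨MonoidHom.mrange h, inferInstance, inferInstance, h.mrangeRestrict,
    (MonoidHom.mrange h).subtype, fun x => ?_, rfl⟩
  -- Regularity in `N` passes to the image because the inverse is a power and so stays in the
  -- submonoid.
  refine (isRegularElt_iff_exists_isInverseOf x).2
    ⟨_, isInverseOf_pow (ω := ω) (by omega) (Subtype.ext ?_)⟩
  rw [SubmonoidClass.coe_pow]
  exact (hreg x x.2).pow_succ_eq (hid x)

/-! ### Coset-preserving homomorphisms and the commutative regularization -/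

theorem mapsTo_abReg_of_factorization {M : Type u} {N K : Type v} [Monoid M] [Monoid N]
    [CommMonoid K] {r : ℕ} {RM : Set (Fin r → M)} {RN : Set (Fin r → N)} (g : M →* K) (ι : K →* N)
    (hK : ∀ x : K, IsRegularElt x)
    (hR : cosetGen ((fun t => (ι.comp g) ∘ t) '' RM) ⊆ RN) :
    (expansion (AbReg M) (cosetGen ((fun t => AbReg.proj M ∘ t) '' RM))).MapsTo
      (expansion N RN) := by
  obtain ⟨φ, hφ, -⟩ := AbReg.existsUnique_lift M hK g
  refine ⟨ι.comp φ, (ι.comp φ).expansion_isHom fun t ht => hR ?_⟩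
  have := image_cosetGen_subset ((ι.comp φ).compLeft (Fin r)) _ (Set.mem_image_of_mem _ ht)
  rw [Set.image_image] at this
  subst hφ
  exact this

theorem exists_hom_of_mapsTo_abReg {M : Type u} {N : Type v} [Monoid M] [Monoid N] {r : ℕ}
    {RM : Set (Fin r → M)} {RN : Set (Fin r → N)}
    (h : (expansion (AbReg M) (cosetGen ((fun t => AbReg.proj M ∘ t) '' RM))).MapsTo
      (expansion N RN)) :
    ∃ h : M → N, (expansion M RM).IsHom (expansion N RN) h ∧
      IsRegularSet (Set.range h) ∧ IsCommutativeSet (Set.range h) ∧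
      cosetGen ((fun t => h ∘ t) '' RM) ⊆ RN := by
  obtain ⟨φ, hφ⟩ := h
  obtain ⟨h1, h2, h3⟩ := expansion_isHom_iff.1 hφ
  let φ' : AbReg M →* N := { toFun := φ, map_one' := h1, map_mul' := h2 }
  refine ⟨φ'.comp (AbReg.proj M), (φ'.comp (AbReg.proj M)).expansion_isHom fun t ht =>
    h3 _ (subset_cosetGen _ ⟨t, ht, rfl⟩), ?_, ?_, ?_⟩
  · rintro _ ⟨a, rfl⟩
    obtain ⟨b, hb⟩ := (isRegularElt_iff_exists_isInverseOf _).1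
      (AbReg.isRegularElt M (AbReg.proj M a))
    exact (isRegularElt_iff_exists_isInverseOf _).2 ⟨_, hb.map φ'⟩
  · rintro _ ⟨a, rfl⟩ _ ⟨b, rfl⟩
    change φ' _ * φ' _ = φ' _ * φ' _
    rw [← map_mul, mul_comm, map_mul]
  · have := cosetGen_image (φ'.compLeft (Fin r)) (U := (fun t => AbReg.proj M ∘ t) '' RM)
      fun t _ => isRegularElt_pi (AbReg.isRegularElt M) t
    rw [Set.image_image] at this
    change cosetGen ((fun t => φ'.compLeft (Fin r) (AbReg.proj M ∘ t)) '' RM) ⊆ RN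
    rw [this]
    rintro _ ⟨t, ht, rfl⟩
    exact h3 t ht

/-! ### The BLP + AIP algorithm -/

namespace RelStructure

variable {Sg : RelSignature} {X A : Type} [Fintype A] {SX : RelStructure Sg X}
  {SA : RelStructure Sg A}

theorem finite_constraint [Finite X] : Finite SX.Constraint := by
  have := Sg.finite_symb
  unfold Constraint
  infer_instance

theorem finite_relaxVar [Finite X] : Finite (SX.RelaxVar SA) := by
  have := finite_constraint (SX := SX)
  unfold RelaxVar
  infer_instance

/-- The combination has the shape required by `affineSpan_induction`; with `s = q` it also gives
midpoints. -/
theorem IsRelaxSolution.affine {K : Type} [CommRing K] {p q s : SX.RelaxVar SA → K} (c : K)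
    (hp : IsRelaxSolution K SX SA p) (hq : IsRelaxSolution K SX SA q)
    (hs : IsRelaxSolution K SX SA s) : IsRelaxSolution K SX SA (c • (p - q) + s) := by
  obtain ⟨p1, p2, p3⟩ := hp
  obtain ⟨q1, q2, q3⟩ := hq
  obtain ⟨s1, s2, s3⟩ := hs
  have sum : ∀ {ι : Type} {_ : Fintype ι} {f g h : ι → K} {a b d : K}, ∑ i, f i = a → ∑ i, g i = b →
      ∑ i, h i = d → ∑ i, (c * (f i - g i) + h i) = c * (a - b) + d := by
    rintro ι _ f g h _ _ _ rfl rfl rfl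
    rw [Finset.sum_add_distrib, ← Finset.mul_sum, Finset.sum_sub_distrib]
  have ite : ∀ (P : Prop) {_ : Decidable P} (x y z : K), (if P then c * (x - y) + z else 0) =
      c * ((if P then x else 0) - if P then y else 0) + if P then z else 0 := by
    intro P _ x y z
    split_ifs <;> ring
  exact ⟨fun x => (sum (p1 x) (q1 x) (s1 x)).trans (by ring),
    fun d => (sum (p2 d) (q2 d) (s2 d)).trans (by ring),
    fun d k a => (Finset.sum_congr rfl fun w _ => ite _ _ _ _).trans
      (sum (p3 d k a) (q3 d k a) (s3 d k a))⟩

/-- If the polytope is non-empty, some point of it has the largest support. -/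
theorem exists_maximal_support [Finite X] {p₀ : SX.RelaxVar SA → ℚ}
    (hp₀ : p₀ ∈ SX.blpPolytope SA) :
    ∃ p ∈ SX.blpPolytope SA, ∀ v, p v = 0 → ∀ q ∈ SX.blpPolytope SA, q v = 0 := by
  have := finite_relaxVar (SX := SX) (SA := SA)
  have := Fintype.ofFinite (SX.RelaxVar SA)
  suffices h : ∀ F : Finset (SX.RelaxVar SA), ∃ p ∈ SX.blpPolytope SA, ∀ v ∈ F, p v = 0 →
      ∀ q ∈ SX.blpPolytope SA, q v = 0 by
    obtain ⟨p, hp, h⟩ := h Finset.univ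
    exact ⟨p, hp, fun v => h v (Finset.mem_univ v)⟩
  classical
  intro F
  induction F using Finset.induction_on with
  | empty => exact ⟨p₀, hp₀, by simp⟩
  | insert v F _ ih =>
    obtain ⟨p, hp, h⟩ := ih
    by_cases hv : ∀ q ∈ SX.blpPolytope SA, q v = 0
    · refine ⟨p, hp, fun w hw h0 => ?_⟩
      rcases Finset.mem_insert.1 hw with rfl | hw
      · exact hv
      · exact h w hw h0
    · push Not at hv
      obtain ⟨q, hq, hqv⟩ := hv
      -- The midpoint of two points of the polytope vanishes only where both do.
      have val : ∀ w, ((1 / 2 : ℚ) • (q - p) + p) w = (q w + p w) / 2 := fun w => by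
        simp only [Pi.add_apply, Pi.smul_apply, Pi.sub_apply, smul_eq_mul]; ring
      refine ⟨(1 / 2 : ℚ) • (q - p) + p, ⟨hq.1.affine _ hp.1 hp.1, fun w => ?_⟩,
        fun w hw h0 => ?_⟩
      · rw [val]
        have := hq.2 w
        have := hp.2 w
        positivity
      · rw [val] at h0
        have h1 := hq.2 w
        have h2 := hp.2 w
        rcases Finset.mem_insert.1 hw with rfl | hw
        · exact absurd (by linarith) hqv
        · exact h w hw (by linarith)

/-- A point of the polytope with the largest support is in the relative interior. -/
theorem mem_intrinsicInterior_of_maximal_support [Finite X] {p : SX.RelaxVar SA → ℚ}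
    (hp : p ∈ SX.blpPolytope SA)
    (h : ∀ v, p v = 0 → ∀ q ∈ SX.blpPolytope SA, q v = 0) :
    p ∈ intrinsicInterior ℚ (SX.blpPolytope SA) := by
  have := finite_relaxVar (SX := SX) (SA := SA)
  refine mem_intrinsicInterior.2 ⟨⟨p, subset_affineSpan ℚ _ hp⟩, ?_, rfl⟩
  -- The neighbourhood consists of the points of the affine span that are positive on the support of
  -- `p`. Off this support all of the span vanishes, so these points are non-negative and lie in the
  -- polytope.
  refine mem_interior.2 ⟨{x | ∀ v, p v ≠ 0 → 0 < x.1 v}, ?_, ?_,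
    fun v hv => (hp.2 v).lt_of_ne' hv⟩
  · rintro ⟨x, hx⟩ hpos
    have hx' : IsRelaxSolution ℚ SX SA x ∧ ∀ v, p v = 0 → x v = 0 := by
      refine affineSpan_induction hx (fun q hq => ⟨hq.1, fun v hv => h v hv q hq⟩) ?_
      rintro c q s t ⟨hq, hq0⟩ ⟨hs, hs0⟩ ⟨ht, ht0⟩
      exact ⟨hq.affine c hs ht, fun v hv => by simp [hq0 v hv, hs0 v hv, ht0 v hv]⟩
    refine ⟨hx'.1, fun v => ?_⟩
    by_cases hv : p v = 0
    · exact (hx'.2 v hv).ge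
    · exact (hpos v hv).le
  · have : {x : affineSpan ℚ (SX.blpPolytope SA) | ∀ v, p v ≠ 0 → 0 < x.1 v} =
        ⋂ v, ⋂ (_ : p v ≠ 0), {x | 0 < x.1 v} := by ext; simp
    rw [this]
    refine isOpen_iInter_of_finite fun v => isOpen_iInter_of_finite fun _ => ?_
    exact isOpen_lt continuous_const ((continuous_apply v).comp continuous_subtype_val)

/-! ### Acceptance from weighted families of assignments. -/

open Classical in
/-- The weighted sum of a family of assignments of values to the vertices and of tuples to the
constraints. -/
noncomputable def weightedPoint {K : Type} [CommRing K] {n : ℕ} (ε : Fin n → K)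
    (vx : X → Fin n → A)
    (vc : ∀ c : SX.Constraint, Fin n → {w : Fin (Sg.arity c.1) → A // w ∈ SA.rel c.1}) :
    SX.RelaxVar SA → K
  | Sum.inl (x, a) => ∑ j, if vx x j = a then ε j else 0
  | Sum.inr ⟨c, w⟩ => ∑ j, if vc c j = w then ε j else 0

/-- The marginal equations follow by reindexing the sum over the family along `e`, which may vary
with the constraint and the position. -/
theorem isRelaxSolution_weightedPoint {K : Type} [CommRing K] {n : ℕ} {ε : Fin n → K}
    (hε : ∑ j, ε j = 1) (vx : X → Fin n → A)
    (vc : ∀ c : SX.Constraint, Fin n → {w : Fin (Sg.arity c.1) → A // w ∈ SA.rel c.1})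
    (h : ∀ c k, ∃ e : Equiv.Perm (Fin n),
      (∀ j, ε (e j) = ε j) ∧ ∀ j, (vc c j).1 k = vx (c.2.1 k) (e j)) :
    IsRelaxSolution K SX SA (weightedPoint ε vx vc) := by
  classical
  refine ⟨fun x => ?_, fun c => ?_, fun c k a => ?_⟩
  · simp only [weightedPoint]
    rw [Finset.sum_comm]
    simpa using hε
  · simp only [weightedPoint]
    rw [Finset.sum_comm]
    simpa using hε
  · obtain ⟨e, he, hv⟩ := h c k
    simp only [weightedPoint]
    rw [← Equiv.sum_comp e fun j => if vx (c.2.1 k) j = a then ε j else 0]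
    simp only [he, ← hv]
    simp only [← Finset.sum_filter]
    rw [Finset.sum_comm' (t' := Finset.univ.filter fun j => (vc c j).1 k = a)
      (s' := fun j => {vc c j})]
    · simp
    · intro w j
      simp only [Finset.mem_filter, Finset.mem_univ, true_and, Finset.mem_singleton]
      constructor
      · rintro ⟨h1, rfl⟩; exact ⟨rfl, h1⟩
      · rintro ⟨rfl, h1⟩; exact ⟨h1, rfl⟩

/-- The algorithm accepts if there is a family of assignments, with integer weights of sum one, that
is consistent up to permutations that preserve the weights. -/
theorem blpaipAccepts_of_family [Finite X] {n : ℕ} {ε : Fin n → ℤ}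
    (hε : ∑ j, ε j = 1) (vx : X → Fin n → A)
    (vc : ∀ c : SX.Constraint, Fin n → {w : Fin (Sg.arity c.1) → A // w ∈ SA.rel c.1})
    (h : ∀ c k, ∃ e : Equiv.Perm (Fin n),
      (∀ j, ε (e j) = ε j) ∧ ∀ j, (vc c j).1 k = vx (c.2.1 k) (e j)) :
    SX.BLPAIPAccepts SA := by
  classical
  have hn : (0 : ℚ) < n := by
    rcases n with _ | n
    · simp at hε
    · positivity
  -- Uniform positive weights give a point of the polytope that is positive at every variable used
  -- by the family, which covers the support of the integer solution.
  have hsol : IsRelaxSolution ℚ SX SA (weightedPoint (fun _ => (1 / n : ℚ)) vx vc) := by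
    refine isRelaxSolution_weightedPoint (by simp [hn.ne']) vx vc fun c k => ?_
    obtain ⟨e, -, he⟩ := h c k
    exact ⟨e, fun _ => rfl, he⟩
  have hp₀ : weightedPoint (fun _ => (1 / n : ℚ)) vx vc ∈ SX.blpPolytope SA := by
    refine ⟨hsol, ?_⟩
    rintro (⟨x, a⟩ | ⟨c, w⟩) <;> exact Finset.sum_nonneg fun j _ => by split_ifs <;> positivity
  obtain ⟨p, hp, hmax⟩ := exists_maximal_support hp₀
  refine ⟨p, mem_intrinsicInterior_of_maximal_support hp hmax, weightedPoint ε vx vc,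
    isRelaxSolution_weightedPoint hε vx vc h, fun v hv => ?_⟩
  have h0 := hmax v hv _ hp₀
  have key : ∀ (P : Fin n → Prop) [DecidablePred P], (∑ j, if P j then (1 / n : ℚ) else 0) = 0 →
      (∑ j, if P j then ε j else 0) = 0 := by
    intro P _ hP
    rw [Finset.sum_eq_zero_iff_of_nonneg fun j _ => by split_ifs <;> positivity] at hP
    refine Finset.sum_eq_zero fun j hj => if_neg fun hPj => ?_
    have := hP j hj
    rw [if_pos hPj] at this
    exact (one_div_pos.2 hn).ne' this
  rcases v with ⟨x, a⟩ | ⟨c, w⟩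
  · exact key (fun j => vx x j = a) h0
  · exact key (fun j => vc c j = w) h0

theorem MapsTo.blpaipAccepts [Finite X] (h : SX.MapsTo SA) : SX.BLPAIPAccepts SA := by
  obtain ⟨φ, hφ⟩ := h
  exact blpaipAccepts_of_family (n := 1) (ε := fun _ => 1) (by simp) (fun x _ => φ x)
    (fun c _ => ⟨φ ∘ c.2.1, hφ c.1 _ c.2.2⟩) fun c k => ⟨1, fun _ => rfl, fun _ => rfl⟩

end RelStructure

namespace RelStructure

/-! ### Templates over finite regular commutative monoids -/

theorem exists_nat_multiple {V : Type*} [Finite V] (p : V → ℚ) (hp : ∀ v, 0 ≤ p v) :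
    ∃ (D : ℕ) (m : V → ℕ), 0 < D ∧ ∀ v, (m v : ℚ) = D * p v := by
  classical
  have := Fintype.ofFinite V
  refine ⟨∏ v, (p v).den, fun v => (p v).num.toNat * ∏ w ∈ Finset.univ.erase v, (p w).den,
    Finset.prod_pos fun v _ => (p v).den_pos, fun v => ?_⟩
  have h1 : ((p v).num.toNat : ℚ) = (p v).num := by
    exact_mod_cast Int.toNat_of_nonneg (Rat.num_nonneg.2 (hp v))
  rw [← Finset.mul_prod_erase _ _ (Finset.mem_univ v), Nat.cast_mul, h1, Nat.cast_mul, mul_right_comm,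
    mul_comm (((p v).den : ℕ) : ℚ), Rat.mul_den_eq_num]

variable {Sg : RelSignature} {X A : Type} [Fintype A] {SX : RelStructure Sg X}
  {SA : RelStructure Sg A}

/-- A point of the polytope and an integer solution whose support is contained in that of the point
combine to natural weights. -/
theorem exists_nat_combination {V : Type*} [Finite V] {p : V → ℚ} {q : V → ℤ} (hp : ∀ v, 0 ≤ p v)
    (hpq : ∀ v, p v = 0 → q v = 0) {ω : ℕ} (hω : 0 < ω) :
    ∃ (z : V → ℕ) (k : ℕ), ∀ v, (z v : ℚ) = q v + k * ω * p v := by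
  have := Fintype.ofFinite V
  obtain ⟨D, m, hm⟩ := exists_nat_multiple p hp
  obtain ⟨C, hC⟩ : ∃ C : ℕ, ∀ v, |q v| ≤ C :=
    ⟨∑ v, (q v).natAbs, fun v => by
      rw [Int.abs_eq_natAbs]
      exact_mod_cast Finset.single_le_sum (f := fun v => (q v).natAbs) (fun _ _ => zero_le)
        (Finset.mem_univ v)⟩
  have hpos : ∀ v, 0 ≤ q v + C * ω * m v := by
    intro v
    rcases Nat.eq_zero_or_pos (m v) with h0 | h0
    · have h1 := hm.2 v
      have hD : (D : ℚ) ≠ 0 := by exact_mod_cast hm.1.ne'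
      rw [h0, Nat.cast_zero, eq_comm, mul_eq_zero, or_iff_right hD] at h1
      simp [hpq v h1, h0]
    · have h1 := (abs_le.1 (hC v)).1
      have h2 : (C : ℤ) ≤ C * ω * m v := by
        exact_mod_cast (by nlinarith [Nat.mul_pos hω h0] : C ≤ C * ω * m v)
      linarith
  -- `D` clears the denominators of `p` and `C` bounds `q`. Where `m v = 0` both `p` and `q` vanish,
  -- and elsewhere `C * ω * m v` outweighs a negative `q v`.
  refine ⟨fun v => (q v + C * ω * m v).toNat, C * D, fun v => ?_⟩
  have h1 : (((q v + C * ω * m v).toNat : ℤ) : ℚ) = ((q v + C * ω * m v : ℤ) : ℚ) :=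
    congrArg _ (Int.toNat_of_nonneg (hpos v))
  push_cast at h1 ⊢
  rw [h1, hm.2 v]
  ring

open Classical in
/-- If the algorithm accepts, the system has a solution in natural numbers, up to the scaling of the
right hand side by a number that is one modulo `ω`. -/
theorem BLPAIPAccepts.exists_nat [Finite X] (h : SX.BLPAIPAccepts SA) {ω : ℕ} (hω : 0 < ω) :
    ∃ (z : SX.RelaxVar SA → ℕ) (k : ℕ),
      (∀ x : X, ∑ a : A, z (Sum.inl (x, a)) = k * ω + 1) ∧
      (∀ c : SX.Constraint, ∑ w, z (Sum.inr ⟨c, w⟩) = k * ω + 1) ∧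
      (∀ (c : SX.Constraint) (k : Fin (Sg.arity c.1)) (a : A),
        ∑ w, (if w.1 k = a then z (Sum.inr ⟨c, w⟩) else 0) = z (Sum.inl (c.2.1 k, a))) := by
  have := finite_relaxVar (SX := SX) (SA := SA)
  obtain ⟨p, hp, q, ⟨q1, q2, q3⟩, hpq⟩ := h
  obtain ⟨⟨p1, p2, p3⟩, hnn⟩ := intrinsicInterior_subset hp
  obtain ⟨z, k, hz⟩ := exists_nat_combination hnn hpq hω
  have sum : ∀ {ι : Type} {_ : Fintype ι} (f : ι → SX.RelaxVar SA),
      ∑ i, p (f i) = 1 → ∑ i, q (f i) = 1 → ∑ i, z (f i) = k * ω + 1 := by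
    intro ι _ f h1 h2
    have h3 : ∑ i, (z (f i) : ℚ) = k * ω + 1 := by
      simp only [hz]
      rw [Finset.sum_add_distrib, ← Finset.mul_sum, h1, ← Int.cast_sum, h2]
      push_cast
      ring
    exact_mod_cast h3
  have marg : ∀ {ι : Type} {_ : Fintype ι} (P : ι → Prop) {_ : DecidablePred P}
      (f : ι → SX.RelaxVar SA) (v : SX.RelaxVar SA),
      (∑ i, if P i then p (f i) else 0) = p v → (∑ i, if P i then q (f i) else 0) = q v →
        (∑ i, if P i then z (f i) else 0) = z v := by
    intro ι _ P _ f v h1 h2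
    rw [← Finset.sum_filter] at h1 h2 ⊢
    have h3 : ∑ i with P i, (z (f i) : ℚ) = z v := by
      simp only [hz]
      rw [Finset.sum_add_distrib, ← Finset.mul_sum, h1, ← Int.cast_sum, h2]
    exact_mod_cast h3
  exact ⟨z, k, fun x => sum _ (p1 x) (q1 x), fun c => sum _ (p2 c) (q2 c),
    fun c k a => marg (fun w : {w // w ∈ SA.rel c.1} => w.1 k = a) _ _ (p3 c k a) (q3 c k a)⟩

/-- If the values form a commutative monoid such that each relation is closed under products whose
number of factors is one modulo `ω`, then the algorithm solves the problem. -/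
theorem solvedByBLPAIP_of_closed {K : Type*} [CommMonoid K] (e : A ≃ K) {ω : ℕ} (hω : 0 < ω)
    (h : ∀ s (z : {w // w ∈ SA.rel s} → ℕ) (F : Finset {w // w ∈ SA.rel s}),
      (∃ k, ∑ w ∈ F, z w = k * ω + 1) →
        (fun k => e.symm (∏ w ∈ F, e (w.1 k) ^ z w)) ∈ SA.rel s) : SA.SolvedByBLPAIP := by
  classical
  intro X _ SX
  refine ⟨fun hacc => ?_, MapsTo.blpaipAccepts⟩
  obtain ⟨z, k, -, z2, z3⟩ := hacc.exists_nat hω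
  -- The marginal equations rewrite this product over values, at each position of a constraint, as a
  -- product over the tuples of the relation.
  refine ⟨fun x => e.symm (∏ a, e a ^ z (Sum.inl (x, a))), fun s t ht => ?_⟩
  let c : SX.Constraint := ⟨s, t, ht⟩
  convert h s (fun w => z (Sum.inr ⟨c, w⟩)) Finset.univ ⟨k, z2 c⟩ using 1
  funext i
  refine congrArg e.symm ?_
  have : ∀ a, z (Sum.inl (t i, a)) =
      ∑ w : {w // w ∈ SA.rel s}, if w.1 i = a then z (Sum.inr ⟨c, w⟩) else 0 :=
    fun a => (z3 c i a).symm
  simp only [this, ← Finset.prod_pow_eq_pow_sum]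
  rw [Finset.prod_comm]
  simp [pow_ite]
end RelStructure

/-- Each `x i` has degree 1, so the product has degree `∑ z i`, which is 1 modulo `ω`. -/
theorem prod_pow_mem_gradedClosure {P ι : Type*} [CommMonoid P] {ω k : ℕ} {U : Set P}
    (F : Finset ι) (x : ι → P) (z : ι → ℕ)
    (hx : ∀ i ∈ F, (x i, Multiplicative.ofAdd 1) ∈ gradedClosure ω U)
    (hz : ∑ i ∈ F, z i = k * ω + 1) :
    (∏ i ∈ F, x i ^ z i, Multiplicative.ofAdd 1) ∈ gradedClosure ω U := by
  convert prod_mem (fun i hi => pow_mem (hx i hi) (z i)) using 1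
  refine Prod.ext (by simp [Prod.fst_prod]) ?_
  have : ((∑ i ∈ F, z i : ℕ) : ZMod ω) = 1 := by rw [hz]; simp
  simp only [Prod.snd_prod, Prod.pow_mk, ← ofAdd_nsmul, nsmul_one, ← ofAdd_sum]
  rw [← this, Nat.cast_sum]

/-- The expansion of a finite regular commutative monoid by a coset is, up to isomorphism, a template
that is solved by the algorithm. -/
theorem exists_solved_template {K : Type v} [CommMonoid K] [Finite K]
    (hK : ∀ x : K, IsRegularElt x) {r : ℕ} (U : Set (Fin r → K)) :
    ∃ (A : Type) (_ : Fintype A) (SA : RelStructure (expSignature r) A),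
      (expansion K (cosetGen U)).MapsTo SA ∧ SA.MapsTo (expansion K (cosetGen U)) ∧
        SA.SolvedByBLPAIP := by
  obtain ⟨ω, hω, hid⟩ := exists_idempotent_exponent K
  -- Templates live in `Type`, so the structure on `K` is transported to `Fin n`.
  obtain ⟨n, ⟨e⟩⟩ := Finite.exists_equiv_fin K
  have hU : ∀ u : Fin r → K, u ^ (ω + 1) = u := fun u =>
    funext fun i => (hK (u i)).pow_succ_eq (hid (u i))
  refine ⟨Fin n, inferInstance, ⟨fun s => {t | e.symm ∘ t ∈ (expansion K (cosetGen U)).rel s}⟩,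
    ⟨e, fun s t ht => ?_⟩, ⟨e.symm, fun s t ht => ht⟩,
    RelStructure.solvedByBLPAIP_of_closed e.symm (by omega : 0 < ω) fun s z F => ?_⟩
  · change e.symm ∘ (e ∘ t) ∈ (expansion K (cosetGen U)).rel s
    rwa [← Function.comp_assoc, e.symm_comp_self, Function.id_comp]
  · rintro ⟨k, hk⟩
    change e.symm ∘ (fun i => e (∏ w ∈ F, e.symm (w.1 i) ^ z w)) ∈ (expansion K (cosetGen U)).rel s
    have : e.symm ∘ (fun i => e (∏ w ∈ F, e.symm (w.1 i) ^ z w)) =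
        fun i => ∏ w ∈ F, e.symm (w.1 i) ^ z w := funext fun i => e.symm_apply_apply _
    rw [this]
    cases s with
    | one =>
      refine Finset.prod_eq_one fun w _ => ?_
      have : e.symm (w.1 (0 : Fin 1)) = 1 := w.2
      rw [this, one_pow]
    | mul =>
      change (∏ w ∈ F, _) * (∏ w ∈ F, _) = ∏ w ∈ F, _
      rw [← Finset.prod_mul_distrib]
      refine Finset.prod_congr rfl fun w _ => ?_
      have : e.symm (w.1 (0 : Fin 3)) * e.symm (w.1 (1 : Fin 3)) = e.symm (w.1 (2 : Fin 3)) := w.2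
      rw [← mul_pow, this]
    | extra =>
      have := mem_cosetGen_of_mem_gradedClosure hω (fun u _ => hU u)
        (prod_pow_mem_gradedClosure F (fun w => e.symm ∘ w.1) z
          (fun w _ => mem_gradedClosure_of_mem_cosetGen (by omega) (fun u _ => hU u) w.2) hk)
      change (fun i : Fin r => ∏ w ∈ F, e.symm (w.1 i) ^ z w) ∈ cosetGen U
      have e2 : (fun i : Fin r => ∏ w ∈ F, e.symm (w.1 i) ^ z w) =
          ∏ w ∈ F, (e.symm ∘ w.1 : Fin r → K) ^ z w :=
        funext fun i => by rw [Finset.prod_apply]; rfl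
      rw [e2]
      exact this

/-- The template is a copy of `K` expanded by the coset generated by the image of `RM` under `g`;
`ι` maps this coset into the coset assumed to lie in `RN`. -/
theorem exists_template_of_hom {M : Type u} {N : Type v} [Monoid M] [Monoid N] [Finite N] {r : ℕ}
    {RM : Set (Fin r → M)} {RN : Set (Fin r → N)} {K : Type v} [CommMonoid K] [Finite K]
    (hK : ∀ x : K, IsRegularElt x) (g : M →* K) (ι : K →* N)
    (hR : cosetGen ((fun t => (ι.comp g) ∘ t) '' RM) ⊆ RN) :
    ∃ (A : Type) (_ : Fintype A) (SA : RelStructure (expSignature r) A),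
      (expansion M RM).MapsTo SA ∧ SA.MapsTo (expansion N RN) ∧ SA.SolvedByBLPAIP := by
  obtain ⟨A, hA, SA, ⟨f, hf⟩, ⟨f', hf'⟩, hs⟩ :=
    exists_solved_template hK ((fun t => g ∘ t) '' RM)
  have hg : (expansion M RM).IsHom (expansion K (cosetGen ((fun t => g ∘ t) '' RM))) g :=
    g.expansion_isHom fun t ht => subset_cosetGen _ ⟨t, ht, rfl⟩
  have hι : (expansion K (cosetGen ((fun t => g ∘ t) '' RM))).IsHom (expansion N RN) ι := by
    refine ι.expansion_isHom fun t ht => hR ?_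
    have := image_cosetGen_subset (ι.compLeft (Fin r)) _ (Set.mem_image_of_mem _ ht)
    rw [Set.image_image] at this
    exact this
  exact ⟨A, hA, SA, ⟨f ∘ g, fun s t ht => hf s _ (hg s t ht)⟩,
    ⟨ι ∘ f', fun s t ht => hι s _ (hf' s t ht)⟩, hs⟩

/-! ### From the algorithm to block symmetric polymorphisms -/

namespace RelStructure

/-- A structure maps to a finite structure as soon as all its finite substructures do. -/
theorem mapsTo_of_finite_substructures {Sg : RelSignature} {Q : Type u} {A : Type v} [Finite A]
    [Nonempty A] (SQ : RelStructure Sg Q) (SA : RelStructure Sg A)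
    (h : ∀ (n : ℕ) (e : Fin n → Q),
      (⟨fun s => {t | e ∘ t ∈ SQ.rel s}⟩ : RelStructure Sg (Fin n)).MapsTo SA) :
    SQ.MapsTo SA := by
  classical
  have loc : ∀ F : Finset Q, ∃ g : Q → A, ∀ s, ∀ t ∈ SQ.rel s, (∀ k, t k ∈ F) →
      g ∘ t ∈ SA.rel s := by
    intro F
    obtain ⟨φ, hφ⟩ := h F.card fun i => (F.equivFin.symm i : Q)
    refine ⟨fun x => if hx : x ∈ F then φ (F.equivFin ⟨x, hx⟩) else Classical.arbitrary A,
      fun s t ht hF => ?_⟩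
    convert hφ s (fun k => F.equivFin ⟨t k, hF k⟩) ?_ using 1
    · funext k
      simp [hF k]
    · change (fun i => (F.equivFin.symm i : Q)) ∘ _ ∈ SQ.rel s
      convert ht using 1
      funext k
      simp
  choose g hg using loc
  -- On every finite set `χ` agrees with `g F` for some larger `F`, and each tuple of a relation
  -- involves only finitely many elements.
  obtain ⟨χ, hχ⟩ := Finset.rado_selection g
  refine ⟨χ, fun s t ht => ?_⟩
  obtain ⟨F, hF, hχF⟩ := hχ (Finset.univ.image t)
  convert hg F s t ht fun k => hF (Finset.mem_image_of_mem _ (Finset.mem_univ k)) using 1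
  exact funext fun k => hχF _ (Finset.mem_image_of_mem _ (Finset.mem_univ k))

/-- Tuples that differ by a permutation that preserves the two blocks. -/
def blockSetoid (M : Type u) (i : ℕ) : Setoid (Fin (2 * i + 1) → M) where
  r a b := ∃ p : Equiv.Perm (Fin (2 * i + 1)),
    (∀ j, (p j : ℕ) < i + 1 ↔ (j : ℕ) < i + 1) ∧ a = b ∘ p
  iseqv :=
    { refl := fun a => ⟨1, fun _ => Iff.rfl, rfl⟩
      symm := by
        rintro a b ⟨p, hp, rfl⟩
        refine ⟨p.symm, fun j => by rw [← hp, p.apply_symm_apply], ?_⟩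
        rw [Function.comp_assoc, p.self_comp_symm, Function.comp_id]
      trans := by
        rintro a b c ⟨p, hp, rfl⟩ ⟨q, hq, rfl⟩
        exact ⟨p.trans q, fun j => (hq _).trans (hp j), rfl⟩ }

/-- Homomorphisms from the quotient of the power by block permutations are the block symmetric
polymorphisms. Representatives chosen at the vertices and at a constraint differ by block
permutations, which preserve weights constant on blocks; the weights 1 and -1 sum to `(i + 1) - i =
1`. -/
theorem SolvedByBLPAIP.exists_twoBlockSymmetric {Sg : RelSignature} {M : Type u} {A : Type}
    [Fintype A] [Nonempty A] {SM : RelStructure Sg M} {SA : RelStructure Sg A}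
    (hA : SA.SolvedByBLPAIP) (hMA : SM.MapsTo SA) (i : ℕ) :
    ∃ f : (Fin (2 * i + 1) → M) → A, SM.IsPolymorphism SA f ∧ IsTwoBlockSymmetric i f := by
  obtain ⟨ψ, hψ⟩ := hMA
  let Q := Quotient (blockSetoid M i)
  let SQ : RelStructure Sg Q :=
    ⟨fun s => {t | ∃ T ∈ (SM.pow (2 * i + 1)).rel s, t = fun k => ⟦T k⟧}⟩
  obtain ⟨φ, hφ⟩ : SQ.MapsTo SA := by
    refine mapsTo_of_finite_substructures SQ SA fun n e => (hA _ _).1 ?_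
    let SX : RelStructure Sg (Fin n) := ⟨fun s => {t | e ∘ t ∈ SQ.rel s}⟩
    change SX.BLPAIPAccepts SA
    have hc : ∀ c : SX.Constraint, ∃ T ∈ (SM.pow (2 * i + 1)).rel c.1,
        e ∘ c.2.1 = fun k => (⟦T k⟧ : Q) := fun c => c.2.2
    choose T hT heq using hc
    refine blpaipAccepts_of_family (ε := fun j => if (j : ℕ) < i + 1 then 1 else -1) ?_
      (fun x j => ψ ((e x).out j)) (fun c j => ⟨fun k => ψ (T c k j), hψ _ _ (hT c j)⟩) ?_
    · rw [Fin.sum_univ_eq_sum_range (fun j => if j < i + 1 then (1 : ℤ) else -1),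
        show 2 * i + 1 = i + 1 + i by ring, Finset.sum_range_add]
      rw [Finset.sum_congr rfl fun j hj => if_pos (Finset.mem_range.1 hj),
        Finset.sum_congr rfl fun j _ => if_neg (by omega)]
      simp
    · intro c k
      have h1 : (⟦T c k⟧ : Q) = ⟦(e (c.2.1 k)).out⟧ := by
        rw [Quotient.out_eq]; exact (congrFun (heq c) k).symm
      obtain ⟨p, hp, hTp⟩ := Quotient.exact h1
      exact ⟨p, fun j => by simp only [hp], fun j => congrArg ψ (congrFun hTp j)⟩
  refine ⟨fun a => φ ⟦a⟧, fun s T hT => hφ s _ ⟨T, hT, rfl⟩, fun p hp a => ?_⟩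
  exact congrArg φ (Quotient.sound ⟨p, hp, rfl⟩)

end RelStructure

/-! ### From block symmetric polymorphisms to homomorphisms with regular commutative image -/

theorem mulSingle_comp_swap {M : Type*} [One M] {n : ℕ} (j k : Fin n) (a : M) :
    (Pi.mulSingle j a : Fin n → M) ∘ Equiv.swap j k = Pi.mulSingle k a := by
  funext x
  simp only [Function.comp_apply, Pi.mulSingle_apply, Equiv.swap_apply_eq_iff,
    Equiv.swap_apply_left]

theorem commute_map_mulSingle {M N : Type*} [Monoid M] [Monoid N] {n : ℕ}
    (F : (Fin n → M) →* N) {j k : Fin n} (hjk : j ≠ k) (a b : M) :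
    Commute (F (Pi.mulSingle j a)) (F (Pi.mulSingle k b)) :=
  (Pi.mulSingle_commute (f := fun _ => M) hjk a b).map F

/-- Transpositions within a block identify the restrictions to its coordinates. The index `i + 1`
makes the second block non-empty, so that coordinate 0 and the last one represent the two blocks. -/
theorem exists_block_components {M N : Type*} [Monoid M] [Monoid N] {i : ℕ}
    (F : (Fin (2 * (i + 1) + 1) → M) →* N) (hF : IsTwoBlockSymmetric (i + 1) F) :
    ∃ c : (M →* N) × (M →* N), ∀ j a,
      F (Pi.mulSingle j a) = if (j : ℕ) < i + 1 + 1 then c.1 a else c.2 a := by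
  have swap : ∀ (j k : Fin (2 * (i + 1) + 1)) (a : M),
      ((j : ℕ) < i + 1 + 1 ↔ (k : ℕ) < i + 1 + 1) →
        F (Pi.mulSingle k a) = F (Pi.mulSingle j a) := by
    intro j k a h
    rw [← mulSingle_comp_swap j k a]
    refine hF (Equiv.swap j k) (fun x => ?_) _
    rw [Equiv.swap_apply_def]
    split_ifs with h1 h2
    · rw [h1, h]
    · rw [h2, h]
    · rfl
  refine ⟨⟨F.comp (MonoidHom.mulSingle (fun _ => M) 0),
    F.comp (MonoidHom.mulSingle (fun _ => M) (Fin.last _))⟩,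
    fun j a => ?_⟩
  split_ifs with hj
  · exact swap 0 j a (by simpa using hj)
  · exact swap (Fin.last _) j a (by rw [Fin.val_last]; omega)

/-- The two components of a block symmetric homomorphism take values in a common commutative
submonoid. -/
theorem exists_commutative_components {M : Type u} {N : Type v} [Monoid M] [Monoid N] {i : ℕ}
    (F : (Fin (2 * (i + 2) + 1) → M) →* N) (g g' : M →* N)
    (hF : ∀ j a, F (Pi.mulSingle j a) = if (j : ℕ) < i + 2 + 1 then g a else g' a) :
    ∃ (K : Type v) (_ : CommMonoid K) (ι : K →* N) (γ γ' : M →* K), Function.Injective ι ∧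
      ι.comp γ = g ∧ ι.comp γ' = g' := by
  -- With index `i + 2` each block has two distinct coordinates, and elements placed at distinct
  -- coordinates commute. This makes each component commute with itself as well as with the other.
  have e0 := hF ⟨0, by omega⟩
  have e1 := hF ⟨1, by omega⟩
  have e2 := hF ⟨i + 3, by omega⟩
  have e3 := hF ⟨i + 4, by omega⟩
  simp only [show 0 < i + 2 + 1 by omega, show 1 < i + 2 + 1 by omega,
    show ¬ i + 3 < i + 2 + 1 by omega, show ¬ i + 4 < i + 2 + 1 by omega, if_true, if_false]
    at e0 e1 e2 e3
  have hcomm : ∀ x ∈ Set.range g ∪ Set.range g', ∀ y ∈ Set.range g ∪ Set.range g',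
      x * y = y * x := by
    rintro _ (⟨a, rfl⟩ | ⟨a, rfl⟩) _ (⟨b, rfl⟩ | ⟨b, rfl⟩)
    · rw [← e0, ← e1]; exact commute_map_mulSingle F (by simp) a b
    · rw [← e0, ← e2]; exact commute_map_mulSingle F (by simp [Fin.ext_iff]) a b
    · rw [← e0, ← e2]; exact commute_map_mulSingle F (by simp [Fin.ext_iff]) a b
    · rw [← e2, ← e3]; exact commute_map_mulSingle F (by simp [Fin.ext_iff]) a b
  let _ : CommMonoid (Submonoid.closure (Set.range g ∪ Set.range g')) :=
    { (inferInstance : Monoid (Submonoid.closure (Set.range g ∪ Set.range g'))) with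
      mul_comm := (Submonoid.isMulCommutative_closure _ hcomm).is_comm.comm }
  exact ⟨Submonoid.closure (Set.range g ∪ Set.range g'), inferInstance, Submonoid.subtype _,
    g.codRestrict _ fun a => Submonoid.subset_closure (Or.inl ⟨a, rfl⟩),
    g'.codRestrict _ fun a => Submonoid.subset_closure (Or.inr ⟨a, rfl⟩),
    Subtype.val_injective, rfl, rfl⟩

theorem map_eq_prod_components {M N K : Type*} [Monoid M] [Monoid N] [CommMonoid K] {n : ℕ}
    (F : (Fin n → M) →* N) (ι : K →* N) (δ : Fin n → M →* K)
    (hF : ∀ j a, F (Pi.mulSingle j a) = ι (δ j a)) (x : Fin n → M) :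
    F x = ι (∏ j, δ j (x j)) := by
  have : F = ι.comp (∏ j, (δ j).comp (Pi.evalMonoidHom (fun _ => M) j)) := by
    refine MonoidHom.pi_ext fun j a => ?_
    rw [hF, MonoidHom.comp_apply, MonoidHom.finsetProd_apply, Finset.prod_eq_single j]
    · simp
    · intro k _ hk
      simp [hk]
    · simp
  rw [this, MonoidHom.comp_apply, MonoidHom.finsetProd_apply]
  rfl

theorem List.prod_range_getD {α K : Type*} [CommMonoid K] (f : α → K) (d : α) (l : List α) :
    ∏ j ∈ Finset.range l.length, f (l.getD j d) = (l.map f).prod := by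
  induction l with
  | nil => simp
  | cons a l ih => 
    rw [List.length_cons, Finset.prod_range_succ', List.map_cons, List.prod_cons, ← ih, mul_comm]
    rfl

theorem List.prod_map_pow_mul_pow {α K : Type*} [CommMonoid K] (f g : α → K) (a b : ℕ)
    (l : List α) :
    (l.map fun t => f t ^ a * g t ^ b).prod = (l.map f).prod ^ a * (l.map g).prod ^ b := by
  induction l with
  | nil => simp
  | cons t l ih => simp [ih, mul_pow, mul_mul_mul_comm]

/-- The relation contains the values of a block symmetric polymorphism at any lists of tuples. -/
theorem components_mem_of_lists {M N K : Type*} [Monoid M] [Monoid N] [CommMonoid K] {i r : ℕ}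
    {RM : Set (Fin r → M)} {RN : Set (Fin r → N)} (F : (Fin (2 * i + 1) → M) →* N)
    (hR : ∀ T : Fin (2 * i + 1) → Fin r → M, (∀ j, T j ∈ RM) → (fun k => F fun j => T j k) ∈ RN)
    (ι : K →* N) (γ γ' : M →* K)
    (hF : ∀ j a, F (Pi.mulSingle j a) = if (j : ℕ) < i + 1 then ι (γ a) else ι (γ' a))
    {d : Fin r → M} (hd : d ∈ RM) {l l' : List (Fin r → M)} (hl : ∀ t ∈ l, t ∈ RM)
    (hl' : ∀ t ∈ l', t ∈ RM) (hlen : l.length = i + 1) (hlen' : l'.length = i) :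
    (fun c => ι ((l.map fun t => γ (t c)).prod * (l'.map fun t => γ' (t c)).prod)) ∈ RN := by
  -- The default `d` is never reached for lists of the given lengths; it makes the lookups total
  -- while keeping them in `RM`.
  have getD_mem : ∀ (m : List (Fin r → M)) (j : ℕ), (∀ t ∈ m, t ∈ RM) → m.getD j d ∈ RM := by
    intro m j hm
    by_cases h : j < m.length
    · rw [List.getD_eq_getElem _ _ h]; exact hm _ (List.getElem_mem h)
    · rw [List.getD_eq_default _ _ (by omega)]; exact hd
  convert hR (fun j => if (j : ℕ) < i + 1 then l.getD j d else l'.getD (j - (i + 1)) d)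
    (fun j => by split_ifs; exacts [getD_mem l _ hl, getD_mem l' _ hl']) using 1
  funext c
  rw [map_eq_prod_components F ι (fun j => if (j : ℕ) < i + 1 then γ else γ')
    (fun j a => by rw [hF]; split_ifs <;> rfl)]
  refine congrArg ι ?_
  rw [← List.prod_range_getD _ d l, ← List.prod_range_getD _ d l', hlen, hlen']
  have : ∀ j : Fin (2 * i + 1), (if (j : ℕ) < i + 1 then γ else γ')
      ((if (j : ℕ) < i + 1 then l.getD j d else l'.getD (j - (i + 1)) d) c) =
      (fun j : ℕ => if j < i + 1 then γ (l.getD j d c) else γ' (l'.getD (j - (i + 1)) d c)) j := by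
    intro j
    dsimp only
    split_ifs <;> rfl
  simp only [this]
  rw [Fin.prod_univ_eq_prod_range (fun j : ℕ => if j < i + 1 then γ (l.getD j d c) else
    γ' (l'.getD (j - (i + 1)) d c)), show 2 * i + 1 = i + 1 + i by ring,
    Finset.prod_range_add _ (i + 1) i]
  congr 1
  · exact Finset.prod_congr rfl fun j hj => (if_pos (Finset.mem_range.1 hj)).symm
  · refine Finset.prod_congr rfl fun j _ => ?_
    rw [if_neg (by omega), Nat.add_sub_cancel_left]

/-- A homomorphism is determined by its values on finitely many generators. This is where finite
generation enters the pigeonhole argument. -/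
theorem finite_monoidHom_of_fg {M N : Type*} [Monoid M] [Monoid N] (hM : Monoid.FG M) [Finite N] :
    Finite (M →* N) := by
  obtain ⟨S, hS⟩ := hM.fg_top
  refine Finite.of_injective (fun (f : M →* N) (s : S) => f s) fun f g h => ?_
  exact MonoidHom.eq_of_eqOn_denseM hS fun s hs => congrFun h ⟨s, hs⟩

theorem exists_hom_of_twoBlockSymmetric {M : Type u} {N : Type v} [Monoid M] [Monoid N]
    (hM : Monoid.FG M) [Finite N] {r : ℕ} {RM : Set (Fin r → M)} {RN : Set (Fin r → N)}
    (h : ∀ i : ℕ, ∃ f : (Fin (2 * i + 1) → M) → N,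
      RelStructure.IsPolymorphism (expansion M RM) (expansion N RN) f ∧
        IsTwoBlockSymmetric i f) :
    ∃ h : M → N, (expansion M RM).IsHom (expansion N RN) h ∧
      IsRegularSet (Set.range h) ∧ IsCommutativeSet (Set.range h) ∧
      cosetGen ((fun t => h ∘ t) '' RM) ⊆ RN := by
  obtain ⟨ω, hω, hid⟩ := exists_idempotent_exponent N
  have := finite_monoidHom_of_fg (N := N) hM
  -- Block sizes `ω * (n + 2) + 1` and `ω * (n + 2)` are fixed modulo `ω`, and both are at least 2,
  -- as commutation requires.
  have hcomp : ∀ n : ℕ, ∃ (c : (M →* N) × (M →* N)) (F : (Fin (2 * (ω * (n + 2)) + 1) → M) →* N),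
      (∀ j a, F (Pi.mulSingle j a) = if (j : ℕ) < ω * (n + 2) + 1 then c.1 a else c.2 a) ∧
      ∀ T : Fin (2 * (ω * (n + 2)) + 1) → Fin r → M, (∀ j, T j ∈ RM) →
        (fun k => F fun j => T j k) ∈ RN := by
    intro n
    obtain ⟨f, hf, hsym⟩ := h (ω * (n + 2))
    obtain ⟨F, rfl, hR⟩ := expansion_isPolymorphism hf
    obtain ⟨i, hi⟩ : ∃ i, ω * (n + 2) = i + 1 :=
      ⟨ω * (n + 2) - 1, by have := Nat.mul_pos (by omega : 0 < ω) (by omega : 0 < n + 2); omega⟩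
    generalize ω * (n + 2) = m at *
    subst hi
    obtain ⟨c, hc⟩ := exists_block_components F hsym
    exact ⟨c, F, hc, hR⟩
  choose c F hF hR using hcomp
  -- Pigeonhole: one pair of components occurs for infinitely many, hence arbitrarily large,
  -- arities.
  obtain ⟨⟨g, g'⟩, hinf⟩ := Finite.exists_infinite_fiber c
  obtain ⟨n₀, hn₀⟩ := (Set.infinite_coe_iff.1 hinf).nonempty
  obtain ⟨K, _, ι, γ, γ', hι, rfl, rfl⟩ : ∃ (K : Type v) (_ : CommMonoid K) (ι : K →* N)
      (γ γ' : M →* K), Function.Injective ι ∧ ι.comp γ = g ∧ ι.comp γ' = g' := by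
    obtain ⟨i, hi⟩ : ∃ i, ω * (n₀ + 2) = i + 2 :=
      ⟨ω * (n₀ + 2) - 2, by have := Nat.mul_le_mul hω.le (by omega : 2 ≤ n₀ + 2); omega⟩
    have hF₀ := hF n₀
    rw [show c n₀ = (g, g') from hn₀] at hF₀
    generalize F n₀ = F₀ at *
    generalize ω * (n₀ + 2) = m at *
    subst hi
    exact exists_commutative_components F₀ g g' hF₀
  have hidK : ∀ x : K, x ^ ω * x ^ ω = x ^ ω := fun x => hι (by simp [hid])
  -- For `n` in the infinite fibre this is `F n` on constant tuples: the exponents `ω * (n + 2) + 1`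
  -- and `ω * (n + 2)` reduce to `ω + 1` and `ω`.
  let η : M →* K := γ ^ (ω + 1) * γ' ^ ω
  have hη : ∀ a, η a = γ a ^ (ω + 1) * γ' a ^ ω := fun a => rfl
  have hpow : ∀ a, η a ^ (ω + 1) = η a := by
    intro a
    rw [hη, mul_pow, ← pow_mul, ← pow_mul, show (ω + 1) * (ω + 1) = ω + 1 + (ω + 1) * ω by ring,
      show ω * (ω + 1) = ω + ω * ω by ring, pow_add_idempotent (hidK _) _ _ (by omega),
      pow_add_idempotent (hidK _) _ _ le_rfl]
  have hcoset : cosetGen ((fun t : Fin r → M => (ι.comp η) ∘ t) '' RM) ⊆ RN := by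
    intro x hx
    obtain ⟨s, l, k, hs, hl, hlen, rfl⟩ := exists_cons_of_mem_gradedClosure hω _
      (mem_gradedClosure_of_mem_cosetGen (by omega) (by
        rintro _ ⟨t, -, rfl⟩
        funext j
        change ι (η (t j)) ^ (ω + 1) = ι (η (t j))
        rw [← map_pow, hpow]) hx)
    -- The arity must leave room for `ω + 1` copies of `l` in the first block and `ω` copies in the
    -- second; `k₁` counts the surplus, in units of `ω`.
    obtain ⟨n, hn, hkn⟩ := (Set.infinite_coe_iff.1 hinf).exists_gt (k * (ω + 1))
    obtain ⟨k₁, hk₁⟩ : ∃ k₁, n + 1 = k₁ + k * (ω + 1) := ⟨n + 1 - k * (ω + 1), by omega⟩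
    have hFn := hF n
    rw [show c n = (ι.comp γ, ι.comp γ') from hn] at hFn
    have hi : ω * (n + 2) = ω + (k₁ + k * (ω + 1)) * ω := by
      rw [show n + 2 = (n + 1) + 1 by ring, hk₁]; ring
    have mem : ∀ a b, ∀ t ∈ List.replicate a s ++ (List.replicate b l).flatten, t ∈ RM := by
      intro a b t ht
      rcases List.mem_append.1 ht with ht | ht
      · rw [(List.mem_replicate.1 ht).2]; exact hs
      · obtain ⟨m, hm, ht⟩ := List.mem_flatten.1 ht
        rw [(List.mem_replicate.1 hm).2] at ht
        exact hl t ht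
    -- Copies of `s` pad both blocks to the exact lengths. Beyond `ω + 1` and `ω` copies the padding
    -- is a multiple of `ω`, so it does not change the powers of `γ (s j)` and `γ' (s j)`.
    have key := components_mem_of_lists (F n) (hR n) ι γ γ' hFn hs
      (mem (ω + 1 + k₁ * ω) (ω + 1)) (mem (ω + (k₁ + k) * ω) ω)
      (by simp [hlen, hi]; ring) (by simp [hlen, hi]; ring)
    convert key using 1
    funext j
    have h1 : (l.map fun t => ι.comp η ∘ t).prod j = ι (l.map fun t => η (t j)).prod := by
      refine (map_list_prod (Pi.evalMonoidHom (fun _ => N) j) _).trans ?_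
      rw [map_list_prod, List.map_map, List.map_map]
      rfl
    rw [Pi.mul_apply, h1]
    change ι (η (s j)) * _ = _
    rw [← map_mul]
    refine congrArg ι ?_
    have h2 : ∀ (δ : M →* K) (a b : ℕ),
        ((List.replicate a s ++ (List.replicate b l).flatten).map fun t => δ (t j)).prod =
          δ (s j) ^ a * (l.map fun t => δ (t j)).prod ^ b := by
      intro δ a b
      simp [List.map_flatten, List.prod_flatten]
    rw [h2, h2, pow_add_idempotent (hidK _) _ _ (by omega),
      pow_add_idempotent (hidK _) _ _ le_rfl]
    simp only [hη]
    rw [List.prod_map_pow_mul_pow, mul_mul_mul_comm]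
  refine ⟨ι.comp η, (ι.comp η).expansion_isHom fun t ht =>
    hcoset (subset_cosetGen _ ⟨t, ht, rfl⟩), ?_, ?_, hcoset⟩
  · rintro _ ⟨a, rfl⟩
    exact (isRegularElt_iff_exists_isInverseOf _).2
      ⟨_, isInverseOf_pow (ω := ω) (by omega) (by rw [MonoidHom.comp_apply, ← map_pow, hpow])⟩
  · rintro _ ⟨a, rfl⟩ _ ⟨b, rfl⟩
    rw [MonoidHom.comp_apply, MonoidHom.comp_apply, ← map_mul, mul_comm, map_mul]

theorem mainTheorem2 {M : Type u} {N : Type v} [Monoid M] [Monoid N]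
    (hM : Monoid.FG M) (hN : Finite N) (r : ℕ)
    (RM : Set (Fin r → M)) (RN : Set (Fin r → N))
    (hMN : (expansion M RM).MapsTo (expansion N RN)) :
    List.TFAE [
      ∃ h : M → N, (expansion M RM).IsHom (expansion N RN) h ∧
        IsRegularSet (Set.range h) ∧ IsCommutativeSet (Set.range h) ∧
        cosetGen ((fun t => h ∘ t) '' RM) ⊆ RN,
      ∀ i : ℕ, ∃ f : (Fin (2 * i + 1) → M) → N,
        RelStructure.IsPolymorphism (expansion M RM) (expansion N RN) f ∧
        IsTwoBlockSymmetric i f,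
      ∃ (A : Type) (_ : Fintype A) (SA : RelStructure (expSignature r) A),
        (expansion M RM).MapsTo SA ∧ SA.MapsTo (expansion N RN) ∧ SA.SolvedByBLPAIP,
      (expansion (AbReg M) (cosetGen ((fun t => AbReg.proj M ∘ t) '' RM))).MapsTo
        (expansion N RN)] := by
  have factor : ∀ h : M → N, (expansion M RM).IsHom (expansion N RN) h →
      ∃ h' : M →* N, ⇑h' = h := fun h hh =>
    ⟨{ toFun := h
       map_one' := (expansion_isHom_iff.1 hh).1
       map_mul' := (expansion_isHom_iff.1 hh).2.1 }, rfl⟩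
  tfae_have 1 → 4 := by
    rintro ⟨h, hh, hreg, hcomm, hR⟩
    obtain ⟨h, rfl⟩ := factor h hh
    obtain ⟨K, _, _, g, ι, hK, rfl⟩ := exists_factorization h hreg hcomm
    exact mapsTo_abReg_of_factorization g ι hK hR
  tfae_have 4 → 1 := exists_hom_of_mapsTo_abReg
  tfae_have 1 → 3 := by
    rintro ⟨h, hh, hreg, hcomm, hR⟩
    obtain ⟨h, rfl⟩ := factor h hh
    obtain ⟨K, _, _, g, ι, hK, rfl⟩ := exists_factorization h hreg hcomm
    exact exists_template_of_hom hK g ι hR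
  tfae_have 3 → 2 := by
    rintro ⟨A, _, SA, hMA, ⟨φ, hφ⟩, hA⟩ i
    have : Nonempty A := ⟨hMA.choose 1⟩
    obtain ⟨f, hf, hsym⟩ := hA.exists_twoBlockSymmetric hMA i
    exact ⟨φ ∘ f, fun s t ht => hφ s _ (hf s t ht), fun p hp a => congrArg φ (hsym p hp a)⟩
  tfae_have 2 → 1 := exists_hom_of_twoBlockSymmetric hM
  tfae_finish
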